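/- Let $K$ be a field, $Q$ a quiver with finitely many vertices, $I$ a two-sided ideal of the path algebra $KQ$, and $\Lambda=KQ/I$ (for instance a gentle algebra). Let $w$ be a string of $(Q,I)$ with vertices $v_0,\dots,v_n$ ($n\ge 0$): a reduced walk in $Q$ such that no path which is a subword of $w$ or of $w^{-1}$ occurs with nonzero coefficient in an element of $I$ (for $I$ generated by paths: no such path lies in $I$). Let $M_w$ be the string module, with standard basis $z_0,\dots,z_n$, and let $\widetilde M_w=M_w\otimes_K K[\epsilon]/(\epsilon^2)$ be the induced module over $\widetilde\Lambda=\Lambda\otimes_K K[\epsilon]/(\epsilon^2)$, with standard basis $z_i\otimes 1,\ z_i\otimes\epsilon$. A submodule of $\widetilde M_w$ is called canonical if it is spanned over $K$ by a subset of this standard basis. Let $\mathcal G$ be the snake graph of $w$: it has square tiles $G_0,\dots,G_n$ in the plane grid, each $G_{k+1}$ being glued to the East or North edge of $G_k$; $G_1$ is to the East of $G_0$ if and only if the first letter of $w$ is direct, and $G_{k-1},G_k,G_{k+1}$ form a zigzag if and only if the two corresponding letters are both direct or both inverse (otherwise they form a straight piece). A double dimer cover of $\mathcal G$ is a multiset $D$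 of edges of $\mathcal G$ such that each vertex is incident to exactly two members of $D$. An edge is a boundary edge if it lies in only one tile. The minimal double dimer cover $D_{\min}$ consists of boundary edges only and contains the West edge of $G_0$ twice; the maximal one $D_{\max}$ is its complement, in which every boundary edge has multiplicity $2$ minus its multiplicity in $D_{\min}$. An upward twist of the tile $G_i$ replaces one copy each of the West and East edges of $G_i$ by one copy each of its South and North edges if $i$ is even, and conversely if $i$ is odd. Write $D\le D'$ if $D'$ arises from $D$ by a finite sequence of upward twists. For canonical submodules $N\subseteq N'$, say that $N'$ is obtained from $N$ by adding a single top at $i$ if $N'/N$ is simple and $N'=N\oplus Kb$ for some $b\in\{z_i\otimes 1,z_i\otimes\epsilon\}$ not in $N$. Then the double dimer covers of $\mathcal G$ form a lattice under $\le$, the canonical submodules of $\widetilde M_w$ form a lattice under sum and intersection, and there is an isomorphism of lattices $D\mapsto N_D$ from the former onto the latter such that: 1. $N_D=0$ if and only if $D=D_{\min}$, and $N_D=\widetilde M_w$ if and only if $D=D_{\max}$; 2. for every boundary edge $e$ of a tile $G_i$, if $m$ is the multiplicity of $e$ in the symmetric difference $D\ominus D_{\min}=(D\cup D_{\min})\setminus(D\cap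 D_{\min})$ (union and intersection being taken with maximal and minimal multiplicities), then $z_i\otimes\epsilon\in N_D$ if and only if $m\ge 1$, and $z_i\otimes 1\in N_D$ if and only if $m\ge 2$; 3. $D'$ covers $D$ if and only if $D'$ arises from $D$ by a single upward twist of some tile; a canonical submodule $N'$ covers $N$ in the canonical submodule lattice if and only if $N'$ is obtained from $N$ by adding a single top; and $D'$ arises from $D$ by an upward twist of $G_i$ if and only if $N_{D'}$ is obtained from $N_D$ by adding a single top at $i$. -/

import Mathlib

open scoped TensorProduct

noncomputable section

/-! ### Path algebras -/

/-- A path of a quiver, bundled with its source and target (trivial paths are included). -/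
structure QPath (Q : Type*) [Quiver Q] where
  src : Q
  tgt : Q
  path : Quiver.Path src tgt

/-- The path algebra `KQ`: the vector space with basis all paths of `Q`.  The product `p * q` of
two paths is the path "first `q`, then `p`" if these can be concatenated, and `0` otherwise, so
that left modules are the same thing as representations of `Q`. -/
def PathAlgebra (K : Type*) [Field K] (Q : Type*) [Quiver Q] : Type _ := QPath Q →₀ K

namespace PathAlgebra

variable {K : Type*} [Field K] {Q : Type*} [Quiver Q]

instance : AddCommGroup (PathAlgebra K Q) := inferInstanceAs (AddCommGroup (QPath Q →₀ K))

instance : Module K (PathAlgebra K Q) := inferInstanceAs (Module K (QPath Q →₀ K))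

/-- The coefficient of the path `p` in an element of the path algebra. -/
def coeff (x : PathAlgebra K Q) (p : QPath Q) : K := (show QPath Q →₀ K from x) p

/-- A path as an element of the path algebra. -/
def of (p : QPath Q) : PathAlgebra K Q := Finsupp.single p (1 : K)

open Classical in
/-- The product of two paths: "first `q`, then `p`", or `0`. -/
def pathMul (p q : QPath Q) : PathAlgebra K Q :=
  if h : q.tgt = p.src then of ⟨q.src, p.tgt, (q.path.cast rfl h).comp p.path⟩ else 0

/-- The `K`-linear map out of the path algebra with prescribed values on paths. -/
def lin {V : Type*} [AddCommGroup V] [Module K V] (f : QPath Q → V) : PathAlgebra K Q →ₗ[K] V :=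
  Finsupp.linearCombination K f

theorem lin_of {V : Type*} [AddCommGroup V] [Module K V] (f : QPath Q → V) (p : QPath Q) :
    lin (K := K) f (of p) = f p := by
  exact (Finsupp.linearCombination_single K (1 : K) p).trans (one_smul K _)

theorem hom_ext {V : Type*} [AddCommGroup V] [Module K V] {f g : PathAlgebra K Q →ₗ[K] V}
    (h : ∀ p, f (of p) = g (of p)) : f = g :=
  Finsupp.lhom_ext' fun p => LinearMap.ext_ring (h p)

theorem ind {P : PathAlgebra K Q → Prop} (zero : P 0) (add : ∀ x y, P x → P y → P (x + y))
    (smul : ∀ (c : K) p, P (c • of p)) (x : PathAlgebra K Q) : P x := by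
  refine Finsupp.induction_linear (motive := P) x zero add fun p c => ?_
  have h : c • of p = (Finsupp.single p c : QPath Q →₀ K) := by
    refine (Finsupp.smul_single c p (1 : K)).trans ?_
    rw [smul_eq_mul, mul_one]
  exact h ▸ smul c p

/-- The multiplication, as a bilinear map. -/
def mulL : PathAlgebra K Q →ₗ[K] PathAlgebra K Q →ₗ[K] PathAlgebra K Q :=
  lin fun p => lin fun q => pathMul p q

instance : Mul (PathAlgebra K Q) := ⟨fun x y => mulL x y⟩

theorem mul_def (x y : PathAlgebra K Q) : x * y = mulL x y := rfl

theorem of_mul_of (p q : QPath Q) : (of p * of q : PathAlgebra K Q) = pathMul p q := by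
  simp [mul_def, mulL, lin_of]

theorem pathMul_comp {a b c : Q} (p : Quiver.Path a b) (q : Quiver.Path b c) :
    (pathMul ⟨b, c, q⟩ ⟨a, b, p⟩ : PathAlgebra K Q) = of ⟨a, c, p.comp q⟩ := by
  simp [pathMul]

theorem pathMul_ne {p q : QPath Q} (h : q.tgt ≠ p.src) :
    (pathMul p q : PathAlgebra K Q) = 0 := by
  simp [pathMul, h]

theorem pathMul_assoc (p q r : QPath Q) :
    mulL (pathMul p q) (of r) = mulL (of p) (pathMul (K := K) q r) := by
  obtain ⟨c', d, p⟩ := p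
  obtain ⟨b', c, q⟩ := q
  obtain ⟨a, b, r⟩ := r
  by_cases h1 : c = c'
  · subst h1
    by_cases h2 : b = b'
    · subst h2
      rw [pathMul_comp, pathMul_comp, ← mul_def, ← mul_def, of_mul_of, of_mul_of, pathMul_comp,
        pathMul_comp, Quiver.Path.comp_assoc]
    · rw [pathMul_comp, ← mul_def, of_mul_of, pathMul_ne, pathMul_ne, map_zero]
      · exact h2
      · exact h2
  · rw [pathMul_ne (p := ⟨c', d, p⟩) (by exact h1), map_zero, LinearMap.zero_apply]
    by_cases h2 : b = b'
    · subst h2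
      rw [pathMul_comp, ← mul_def, of_mul_of, pathMul_ne]
      exact h1
    · rw [pathMul_ne (p := ⟨b', c, q⟩) (by exact h2), map_zero]

instance [Fintype Q] : One (PathAlgebra K Q) := ⟨∑ v : Q, of ⟨v, v, Quiver.Path.nil⟩⟩

theorem one_def [Fintype Q] :
    (1 : PathAlgebra K Q) = ∑ v : Q, of ⟨v, v, Quiver.Path.nil⟩ := rfl

theorem mul_assoc_aux (x y z : PathAlgebra K Q) : mulL (mulL x y) z = mulL x (mulL y z) := by
  have h : (LinearMap.llcomp K _ _ _ (mulL (K := K) (Q := Q))).comp mulL =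
      ((LinearMap.llcomp K _ _ _).flip (mulL (K := K) (Q := Q))).comp
        ((LinearMap.llcomp K (PathAlgebra K Q) _ _).comp mulL) := by
    refine hom_ext fun p => hom_ext fun q => hom_ext fun r => ?_
    simp only [LinearMap.comp_apply, LinearMap.llcomp_apply, LinearMap.flip_apply]
    rw [← mul_def (of p), ← mul_def (of q), of_mul_of, of_mul_of, pathMul_assoc]
  exact DFunLike.congr_fun (DFunLike.congr_fun (DFunLike.congr_fun h x) y) z

theorem one_mul_aux [Fintype Q] (x : PathAlgebra K Q) : mulL 1 x = x := by
  have h : mulL (1 : PathAlgebra K Q) = LinearMap.id := by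
    refine hom_ext fun p => ?_
    rw [one_def, map_sum, LinearMap.sum_apply, Finset.sum_eq_single p.tgt]
    · obtain ⟨a, b, p⟩ := p
      rw [← mul_def, of_mul_of, pathMul_comp]
      rfl
    · intro v _ hv
      rw [← mul_def, of_mul_of, pathMul_ne]
      exact fun h => hv h.symm
    · simp
  rw [h, LinearMap.id_apply]

theorem mul_one_aux [Fintype Q] (x : PathAlgebra K Q) : mulL x 1 = x := by
  have h : mulL.flip (1 : PathAlgebra K Q) = LinearMap.id := by
    refine hom_ext fun p => ?_
    rw [one_def, map_sum, LinearMap.sum_apply, Finset.sum_eq_single p.src]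
    · obtain ⟨a, b, p⟩ := p
      rw [LinearMap.flip_apply, ← mul_def, of_mul_of, pathMul_comp, Quiver.Path.nil_comp]
      rfl
    · intro v _ hv
      rw [LinearMap.flip_apply, ← mul_def, of_mul_of, pathMul_ne]
      exact hv
    · simp
  exact DFunLike.congr_fun h x

instance [Fintype Q] : Ring (PathAlgebra K Q) :=
  { (inferInstance : AddCommGroup (PathAlgebra K Q)) with
    mul := fun x y => mulL x y
    one := 1
    left_distrib := fun x y z => map_add (mulL x) y z
    right_distrib := fun x y z => by
      change mulL (x + y) z = mulL x z + mulL y z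
      rw [map_add, LinearMap.add_apply]
    zero_mul := fun x => by
      change mulL 0 x = 0
      rw [map_zero, LinearMap.zero_apply]
    mul_zero := fun x => map_zero (mulL x)
    mul_assoc := mul_assoc_aux
    one_mul := one_mul_aux
    mul_one := mul_one_aux }

instance [Fintype Q] : Algebra K (PathAlgebra K Q) :=
  Algebra.ofModule
    (fun r x y => by
      change mulL (r • x) y = r • mulL x y
      rw [map_smul, LinearMap.smul_apply])
    (fun r x y => map_smul (mulL x) r y)

end PathAlgebra

/-! ### Strings and string modules -/

/-- A walk in a quiver: vertices `v_0, …, v_n` and letters `0, …, n - 1`, where the `k`-th letter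
joins `v_k` to `v_{k+1}` and is either an arrow `v_k ⟶ v_{k+1}` (a direct letter) or the formal
inverse of an arrow `v_{k+1} ⟶ v_k` (an inverse letter).  The case `n = 0` is a trivial walk. -/
structure QWalk (Q : Type*) [Quiver Q] where
  length : ℕ
  vertex : Fin (length + 1) → Q
  arrow : Fin length → Quiver.Total Q
  direct : Fin length → Bool
  start_eq : ∀ k, vertex k.castSucc = if direct k then (arrow k).left else (arrow k).right
  end_eq : ∀ k, vertex k.succ = if direct k then (arrow k).right else (arrow k).left

namespace QWalk

variable {Q : Type*} [Quiver Q] (w : QWalk Q)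

/-- The walk contains the arrow `α` as a letter that leads from position `i` to position `j`
(so `j = i + 1` for a direct letter, and `i = j + 1` for an inverse letter). -/
def Step (α : Quiver.Total Q) (i j : Fin (w.length + 1)) : Prop :=
  ∃ k : Fin w.length, w.arrow k = α ∧
    ((w.direct k = true ∧ i = k.castSucc ∧ j = k.succ) ∨
      (w.direct k = false ∧ i = k.succ ∧ j = k.castSucc))

/-- The path `p` of the quiver is the subword of `w` (if `i ≤ j`), or the inverse of the subword
of `w` (if `j ≤ i`), that leads from position `i` to position `j`. -/
def Reads : {a b : Q} → Quiver.Path a b → Fin (w.length + 1) → Fin (w.length + 1) → Prop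
  | a, _, .nil, i, j => i = j ∧ w.vertex i = a
  | _, _, .cons p α, i, j => ∃ k, Reads p i k ∧ w.Step ⟨_, _, α⟩ k j

/-- No letter is followed by its own inverse. -/
def Reduced : Prop :=
  ∀ k l : Fin w.length, l.val = k.val + 1 → w.arrow k = w.arrow l → w.direct k = w.direct l

variable {K : Type*} [Field K]

/-- A string of the bound quiver `(Q, I)`: a reduced walk that avoids the relations, that is, no
path which is a subword of `w` or of its inverse occurs in an element of `I`.  When `I` is spanned
by paths, as for gentle and other monomial algebras, this says that no such path lies in `I`. -/
def IsString [Fintype Q] (I : Ideal (PathAlgebra K Q)) : Prop :=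
  w.Reduced ∧ ∀ x ∈ I, ∀ p : QPath Q, ∀ i j, w.Reads p.path i j → x.coeff p = 0

/-- The underlying vector space of the string module of `w`, with basis `z_0, …, z_n`. -/
abbrev Space (K : Type*) [Field K] : Type _ := Fin (w.length + 1) →₀ K

variable (K)

open Classical in
/-- The action of a vertex `v` (a trivial path): `z_i ↦ z_i` if `v_i = v`, and `z_i ↦ 0`
otherwise. -/
def vertexAct (v : Q) : Module.End K (w.Space K) :=
  Finsupp.linearCombination K fun i => if w.vertex i = v then Finsupp.single i 1 else 0

open Classical in
/-- The action of an arrow: `z_i ↦ z_j` if `α` is a letter of `w` from position `i` to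
position `j`. -/
def arrowAct (α : Quiver.Total Q) : Module.End K (w.Space K) :=
  Finsupp.linearCombination K fun i =>
    ∑ j, if w.Step α i j then Finsupp.single j 1 else 0

/-- The action of a path. -/
def pathAct : {a b : Q} → Quiver.Path a b → Module.End K (w.Space K)
  | a, _, .nil => w.vertexAct K a
  | _, _, .cons p α => w.arrowAct K ⟨_, _, α⟩ * pathAct p

theorem step_vertex {α : Quiver.Total Q} {i j : Fin (w.length + 1)} (h : w.Step α i j) :
    w.vertex i = α.left ∧ w.vertex j = α.right := by
  obtain ⟨k, rfl, ⟨hd, rfl, rfl⟩ | ⟨hd, rfl, rfl⟩⟩ := h <;>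
    simp [w.start_eq, w.end_eq, hd]

theorem vertexAct_mul_self (v : Q) : w.vertexAct K v * w.vertexAct K v = w.vertexAct K v := by
  refine Finsupp.lhom_ext' fun i => LinearMap.ext_ring ?_
  by_cases h : w.vertex i = v <;> simp [vertexAct, h]

theorem vertexAct_mul_ne {u v : Q} (huv : u ≠ v) : w.vertexAct K u * w.vertexAct K v = 0 := by
  refine Finsupp.lhom_ext' fun i => LinearMap.ext_ring ?_
  by_cases h : w.vertex i = v
  · simp [vertexAct, h, huv.symm]
  · simp [vertexAct, h]

theorem vertexAct_mul_arrowAct (α : Quiver.Total Q) :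
    w.vertexAct K α.right * w.arrowAct K α = w.arrowAct K α := by
  refine Finsupp.lhom_ext' fun i => LinearMap.ext_ring ?_
  simp only [arrowAct, LinearMap.comp_apply, Module.End.mul_apply, Finsupp.lsingle_apply,
    Finsupp.linearCombination_single, one_smul, map_sum]
  refine Finset.sum_congr rfl fun j _ => ?_
  by_cases h : w.Step α i j
  · simp [vertexAct, h, (w.step_vertex h).2]
  · simp [h]

theorem arrowAct_mul_vertexAct (α : Quiver.Total Q) :
    w.arrowAct K α * w.vertexAct K α.left = w.arrowAct K α := by
  refine Finsupp.lhom_ext' fun i => LinearMap.ext_ring ?_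
  by_cases h : w.vertex i = α.left
  · simp [vertexAct, h]
  · have : ∀ j, ¬ w.Step α i j := fun j hj => h (w.step_vertex hj).1
    simp [vertexAct, arrowAct, h, this]

theorem vertexAct_mul_pathAct {a b : Q} (p : Quiver.Path a b) :
    w.vertexAct K b * w.pathAct K p = w.pathAct K p := by
  cases p with
  | nil => rw [pathAct, w.vertexAct_mul_self K]
  | cons p α => rw [pathAct, ← mul_assoc, w.vertexAct_mul_arrowAct K ⟨_, _, α⟩]

theorem pathAct_mul_vertexAct {a b : Q} (p : Quiver.Path a b) :
    w.pathAct K p * w.vertexAct K a = w.pathAct K p := by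
  induction p with
  | nil => rw [pathAct, w.vertexAct_mul_self K]
  | cons p α ih => rw [pathAct, mul_assoc, ih]

theorem pathAct_comp {a b c : Q} (p : Quiver.Path a b) (q : Quiver.Path b c) :
    w.pathAct K (p.comp q) = w.pathAct K q * w.pathAct K p := by
  induction q with
  | nil => rw [Quiver.Path.comp_nil, pathAct, w.vertexAct_mul_pathAct K]
  | cons q α ih => rw [Quiver.Path.comp_cons, pathAct, pathAct, ih, mul_assoc]

theorem pathAct_pathMul (p q : QPath Q) :
    PathAlgebra.lin (K := K) (fun p => w.pathAct K p.path) (PathAlgebra.pathMul p q) =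
      w.pathAct K p.path * w.pathAct K q.path := by
  obtain ⟨b', c, p⟩ := p
  obtain ⟨a, b, q⟩ := q
  by_cases h : b = b'
  · subst h
    rw [PathAlgebra.pathMul_comp, PathAlgebra.lin_of, pathAct_comp]
  · rw [PathAlgebra.pathMul_ne (by exact h), map_zero]
    change 0 = w.pathAct K p * w.pathAct K q
    rw [← w.pathAct_mul_vertexAct K p, ← w.vertexAct_mul_pathAct K q, mul_assoc,
      ← mul_assoc (w.vertexAct K b'), w.vertexAct_mul_ne K (Ne.symm h), zero_mul, mul_zero]

/-- The representation of `Q` attached to the walk, as an algebra homomorphism. -/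
def rep [Fintype Q] : PathAlgebra K Q →ₐ[K] Module.End K (w.Space K) :=
  AlgHom.ofLinearMap (PathAlgebra.lin fun p => w.pathAct K p.path)
    (by
      classical
      rw [PathAlgebra.one_def, map_sum]
      simp only [PathAlgebra.lin_of]
      refine Finsupp.lhom_ext' fun i => LinearMap.ext_ring ?_
      simp only [pathAct, vertexAct, LinearMap.comp_apply, LinearMap.sum_apply,
        Finsupp.lsingle_apply, Finsupp.linearCombination_single, one_smul]
      rw [Finset.sum_eq_single (w.vertex i)]
      · simp
      · intro v _ hv
        rw [if_neg (Ne.symm hv)]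
      · simp)
    (by
      intro x y
      change PathAlgebra.lin _ (PathAlgebra.mulL x y) = _
      induction x using PathAlgebra.ind with
      | zero => rw [map_zero, LinearMap.zero_apply, map_zero, zero_mul]
      | add x x' hx hx' => rw [map_add, LinearMap.add_apply, map_add, hx, hx', map_add, add_mul]
      | smul c p =>
        induction y using PathAlgebra.ind with
        | zero => rw [map_zero, map_zero, mul_zero]
        | add y y' hy hy' => rw [map_add, map_add, hy, hy', map_add, mul_add]
        | smul d q =>
          simp only [map_smul, LinearMap.smul_apply]
          rw [← PathAlgebra.mul_def, PathAlgebra.of_mul_of, pathAct_pathMul, PathAlgebra.lin_of,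
            PathAlgebra.lin_of, mul_smul_comm, smul_mul_assoc])

theorem pathAct_single_mem {a b : Q} (p : Quiver.Path a b) (i : Fin (w.length + 1)) :
    w.pathAct K p (Finsupp.single i 1) ∈
      Submodule.span K {z : w.Space K | ∃ j, w.Reads p i j ∧ z = Finsupp.single j 1} := by
  classical
  induction p with
  | nil =>
    by_cases h : w.vertex i = a
    · simp only [pathAct, vertexAct, Finsupp.linearCombination_single, one_smul, if_pos h]
      exact Submodule.subset_span ⟨i, by simp [Reads, h], rfl⟩
    · simp [pathAct, vertexAct, h]
  | cons p α ih =>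
    rw [pathAct, Module.End.mul_apply]
    refine Submodule.span_induction (p := fun x _ => w.arrowAct K ⟨_, _, α⟩ x ∈ _) ?_ ?_ ?_ ?_ ih
    · rintro _ ⟨k, hk, rfl⟩
      simp only [arrowAct, Finsupp.linearCombination_single, one_smul]
      refine Submodule.sum_mem _ fun j _ => ?_
      split_ifs with hj
      · exact Submodule.subset_span ⟨j, by rw [Reads]; exact ⟨k, hk, hj⟩, rfl⟩
      · exact Submodule.zero_mem _
    · rw [map_zero]; exact Submodule.zero_mem _
    · intro x y _ _ hx hy
      rw [map_add]; exact Submodule.add_mem _ hx hy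
    · intro c x _ hx
      rw [map_smul]; exact Submodule.smul_mem _ c hx

variable {K}

/-- The relations act by zero on the representation attached to a string. -/
theorem IsString.rep_eq_zero [Fintype Q] {w : QWalk Q} {I : Ideal (PathAlgebra K Q)}
    (hw : w.IsString I) (x : PathAlgebra K Q) (hx : x ∈ I) : w.rep K x = 0 := by
  refine Finsupp.lhom_ext' fun i => LinearMap.ext_ring ?_
  have h : w.rep K x = Finsupp.sum (show QPath Q →₀ K from x)
      fun p c => c • w.pathAct K p.path := rfl
  rw [h, Finsupp.sum, LinearMap.comp_apply, LinearMap.sum_apply]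
  refine Finset.sum_eq_zero fun p hp => ?_
  have hno : {z : w.Space K | ∃ j, w.Reads p.path i j ∧ z = Finsupp.single j 1} = ∅ := by
    refine Set.eq_empty_of_forall_notMem ?_
    rintro z ⟨j, hj, -⟩
    exact Finsupp.mem_support_iff.mp hp (hw.2 x hx p i j hj)
  have hz := w.pathAct_single_mem K p.path i
  rw [hno, Submodule.span_empty, Submodule.mem_bot] at hz
  rw [LinearMap.smul_apply, Finsupp.lsingle_apply, hz, smul_zero]

end QWalk

section Modules

variable {K : Type*} [Field K] {Q : Type*} [Quiver Q] [Fintype Q]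
  {I : Ideal (PathAlgebra K Q)} {w : QWalk Q}

/-- The string module `M_w` over the bound quiver algebra `Λ = KQ / I`: the vector space with
basis `z_0, …, z_n` indexed by the positions of `w`. -/
def StringModule (_hw : w.IsString I) : Type _ := w.Space K

instance (hw : w.IsString I) : AddCommGroup (StringModule hw) :=
  inferInstanceAs (AddCommGroup (w.Space K))

instance (hw : w.IsString I) : Module K (StringModule hw) :=
  inferInstanceAs (Module K (w.Space K))

/-- The standard basis vector `z_i` of `M_w`. -/
def StringModule.z (hw : w.IsString I) (i : Fin (w.length + 1)) : StringModule hw :=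
  Finsupp.single i (1 : K)

/-- The induced module `M_w ⊗ K[ε]/(ε²)` of a string module. -/
def InducedModule (hw : w.IsString I) : Type _ := StringModule hw ⊗[K] DualNumber K

instance (hw : w.IsString I) : AddCommGroup (InducedModule hw) :=
  inferInstanceAs (AddCommGroup (StringModule hw ⊗[K] DualNumber K))

instance (hw : w.IsString I) : Module K (InducedModule hw) :=
  inferInstanceAs (Module K (StringModule hw ⊗[K] DualNumber K))

/-- The standard basis vectors of the induced module: `z_i ⊗ 1` (for `(i, false)`) and `z_i ⊗ ε`
(for `(i, true)`). -/
def InducedModule.stdVec (hw : w.IsString I) (b : Fin (w.length + 1) × Bool) : InducedModule hw :=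
  StringModule.z hw b.1 ⊗ₜ[K] (if b.2 then DualNumber.eps else 1)

variable [I.IsTwoSided]

/-- The action of `Λ = KQ / I` on `M_w`. -/
def stringRep (hw : w.IsString I) : (PathAlgebra K Q ⧸ I) →ₐ[K] Module.End K (StringModule hw) :=
  Ideal.Quotient.liftₐ I (w.rep K) hw.rep_eq_zero

instance (hw : w.IsString I) : Module (PathAlgebra K Q ⧸ I) (StringModule hw) :=
  Module.compHom _ (stringRep hw).toRingHom

variable (I) in
/-- The algebra `Λ ⊗ K[ε]/(ε²)`, for `Λ = KQ / I`. -/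
def DualAlgebra : Type _ := (PathAlgebra K Q ⧸ I) ⊗[K] DualNumber K

instance : Ring (DualAlgebra I) :=
  inferInstanceAs (Ring ((PathAlgebra K Q ⧸ I) ⊗[K] DualNumber K))

instance : Algebra K (DualAlgebra I) :=
  inferInstanceAs (Algebra K ((PathAlgebra K Q ⧸ I) ⊗[K] DualNumber K))

/-- The action `(a ⊗ e) • (m ⊗ e') = (a • m) ⊗ (e * e')` on the induced module. -/
def inducedRep (hw : w.IsString I) : DualAlgebra I →ₐ[K] Module.End K (InducedModule hw) :=
  (Module.endTensorEndAlgHom (R := K) (S := K) (A := K) (M := StringModule hw)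
    (N := DualNumber K)).comp
    (Algebra.TensorProduct.map (stringRep hw) (Algebra.lmul K (DualNumber K)))

instance (hw : w.IsString I) : Module (DualAlgebra I) (InducedModule hw) :=
  Module.compHom _ (inducedRep hw).toRingHom

/-- A submodule of the induced module is canonical if it is spanned, as a vector space, by a
subset of the standard basis. -/
def IsCanonical {hw : w.IsString I} (N : Submodule (DualAlgebra I) (InducedModule hw)) : Prop :=
  ∃ S : Set (Fin (w.length + 1) × Bool),
    (N : Set (InducedModule hw)) = Submodule.span K (InducedModule.stdVec hw '' S)

/-- The canonical submodules of the induced module, ordered by inclusion. -/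
abbrev CanonicalSubmodule (hw : w.IsString I) : Type _ :=
  {N : Submodule (DualAlgebra I) (InducedModule hw) // IsCanonical N}

/-- `N'` is obtained from `N` by adding a single top at position `i` of the string: `N'` contains
`N`, the quotient `N' / N` is simple, and it is spanned by the class of `z_i ⊗ 1` or `z_i ⊗ ε`. -/
def AddsTop {hw : w.IsString I} (i : Fin (w.length + 1))
    (N N' : Submodule (DualAlgebra I) (InducedModule hw)) : Prop :=
  N ≤ N' ∧ IsSimpleModule (DualAlgebra I) (N' ⧸ N.submoduleOf N') ∧
    ∃ c : Bool, InducedModule.stdVec hw (i, c) ∉ N ∧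
      (N' : Set (InducedModule hw)) =
        Submodule.span K ((N : Set (InducedModule hw)) ∪ {InducedModule.stdVec hw (i, c)})

end Modules

/-! ### Snake graphs and double dimer covers -/

/-- The two directions in which a tile of a snake graph may be attached to the previous one. -/
inductive SnakeDir
  | east
  | north
  deriving DecidableEq

/-- A snake graph with `n + 1` square tiles; `step k` tells whether the tile with index `k + 1` is
attached to the East or to the North edge of the tile with index `k` (indices start from `0`). -/
structure SnakeGraph (n : ℕ) where
  step : Fin n → SnakeDir

namespace SnakeGraph

variable {n : ℕ} (G : SnakeGraph n)

/-- The horizontal coordinate of the South-West corner of a tile. -/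
def xPos (i : Fin (n + 1)) : ℕ :=
  (Finset.univ.filter fun k : Fin n => k.castSucc < i ∧ G.step k = SnakeDir.east).card

/-- The vertical coordinate of the South-West corner of a tile. -/
def yPos (i : Fin (n + 1)) : ℕ :=
  (Finset.univ.filter fun k : Fin n => k.castSucc < i ∧ G.step k = SnakeDir.north).card

/-- The West edge of a tile. -/
def west (i : Fin (n + 1)) : Sym2 (ℕ × ℕ) := s((G.xPos i, G.yPos i), (G.xPos i, G.yPos i + 1))

/-- The East edge of a tile. -/
def east (i : Fin (n + 1)) : Sym2 (ℕ × ℕ) :=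
  s((G.xPos i + 1, G.yPos i), (G.xPos i + 1, G.yPos i + 1))

/-- The South edge of a tile. -/
def south (i : Fin (n + 1)) : Sym2 (ℕ × ℕ) := s((G.xPos i, G.yPos i), (G.xPos i + 1, G.yPos i))

/-- The North edge of a tile. -/
def north (i : Fin (n + 1)) : Sym2 (ℕ × ℕ) :=
  s((G.xPos i, G.yPos i + 1), (G.xPos i + 1, G.yPos i + 1))

/-- The four edges of a tile. -/
def tileEdges (i : Fin (n + 1)) : Set (Sym2 (ℕ × ℕ)) :=
  {G.west i, G.east i, G.south i, G.north i}

/-- The edges of the snake graph. -/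
def edges : Set (Sym2 (ℕ × ℕ)) := {e | ∃ i, e ∈ G.tileEdges i}

/-- The vertices of the snake graph: the corners of its tiles. -/
def vertices : Set (ℕ × ℕ) := {v | ∃ e ∈ G.edges, v ∈ e}

/-- Boundary edges are the edges that belong to exactly one tile. -/
def IsBoundary (e : Sym2 (ℕ × ℕ)) : Prop := ∃! i, e ∈ G.tileEdges i

/-- A double dimer cover: a multiset of edges such that each vertex is incident to exactly two
of its members. -/
def DoubleDimerCover : Type :=
  {D : Multiset (Sym2 (ℕ × ℕ)) // (∀ e ∈ D, e ∈ G.edges) ∧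
    ∀ v ∈ G.vertices, (D.filter fun e => v ∈ e).card = 2}

/-- The minimal double dimer cover: it consists of boundary edges and contains two copies of the
West edge of the first tile. -/
def IsMinimal (D : G.DoubleDimerCover) : Prop :=
  (∀ e ∈ D.val, G.IsBoundary e) ∧ D.val.count (G.west 0) = 2

/-- The maximal double dimer cover: it consists of boundary edges and is complementary to the
minimal one. -/
def IsMaximal (D : G.DoubleDimerCover) : Prop :=
  (∀ e ∈ D.val, G.IsBoundary e) ∧ ∀ D₀ : G.DoubleDimerCover, G.IsMinimal D₀ →
    ∀ e, G.IsBoundary e → D.val.count e + D₀.val.count e = 2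

/-- The symmetric difference of multisets, with respect to maxima and minima of multiplicities. -/
def multisetSymmDiff (D D' : Multiset (Sym2 (ℕ × ℕ))) : Multiset (Sym2 (ℕ × ℕ)) :=
  (D ∪ D') - (D ∩ D')

/-- `D'` arises from `D` by an upward twist of the tile with index `i`, which replaces one copy of
each of two opposite edges of the tile by one copy of each of the two other edges.  The direction
away from the minimal double dimer cover is West/East to South/North on the first, third, …
tile and South/North to West/East on the second, fourth, … tile. -/
def UpTwist (i : Fin (n + 1)) (D D' : G.DoubleDimerCover) : Prop :=
  ∃ R : Multiset (Sym2 (ℕ × ℕ)),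
    if Even i.val then
      D.val = R + {G.west i, G.east i} ∧ D'.val = R + {G.south i, G.north i}
    else
      D.val = R + {G.south i, G.north i} ∧ D'.val = R + {G.west i, G.east i}

/-- A weight on the edges whose sum increases under upward twists. -/
def edgeWeight : Sym2 (ℕ × ℕ) → ℤ :=
  Sym2.lift ⟨fun p q => if p.1 = q.1 then (-1) ^ (p.1 + min p.2 q.2) * p.1 else 0, fun p q => by
    by_cases h : p.1 = q.1
    · simp [h, min_comm]
    · simp [h, Ne.symm h]⟩

theorem xPos_add_yPos (i : Fin (n + 1)) : G.xPos i + G.yPos i = i.val := by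
  have h : (Finset.univ.filter fun k : Fin n => k.castSucc < i).card = i.val := by
    have := Fin.card_filter_val_lt (n := n) (m := i.val)
    rw [min_eq_right (Nat.lt_succ_iff.mp i.isLt)] at this
    exact this
  have h' : (Finset.univ.filter fun k : Fin n => k.castSucc < i ∧ G.step k = SnakeDir.north) =
      Finset.univ.filter fun k : Fin n => k.castSucc < i ∧ ¬ G.step k = SnakeDir.east := by
    ext k
    cases hk : G.step k <;> simp [hk]
  rw [xPos, yPos, h', ← h, ← Finset.filter_filter, ← Finset.filter_filter,
    Finset.card_filter_add_card_filter_not]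

theorem UpTwist.weight_lt {G : SnakeGraph n} {i : Fin (n + 1)} {D D' : G.DoubleDimerCover}
    (h : G.UpTwist i D D') :
    (D.val.map edgeWeight).sum < (D'.val.map edgeWeight).sum := by
  obtain ⟨R, h⟩ := h
  have hw : edgeWeight (G.west i) = (-1) ^ i.val * (G.xPos i : ℤ) := by
    simp [west, edgeWeight, G.xPos_add_yPos]
  have he : edgeWeight (G.east i) = - ((-1) ^ i.val * (G.xPos i + 1 : ℤ)) := by
    have : G.xPos i + 1 + G.yPos i = i.val + 1 := by rw [← G.xPos_add_yPos i]; ring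
    simp [east, edgeWeight, this, pow_succ]
  have hs : edgeWeight (G.south i) = 0 := by simp [south, edgeWeight]
  have hn : edgeWeight (G.north i) = 0 := by simp [north, edgeWeight]
  split_ifs at h with hi
  · simp [h.1, h.2, hw, he, hs, hn, hi.neg_one_pow]
    linarith
  · simp [h.1, h.2, hw, he, hs, hn, (Nat.not_even_iff_odd.mp hi).neg_one_pow]
    linarith

/-- Double dimer covers are ordered by upward twists: `D ≤ D'` if `D'` is obtained from `D` by a
finite (possibly empty) sequence of upward twists. -/
instance : PartialOrder G.DoubleDimerCover where
  le := Relation.ReflTransGen fun D D' => ∃ i, G.UpTwist i D D'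
  le_refl _ := Relation.ReflTransGen.refl
  le_trans _ _ _ := Relation.ReflTransGen.trans
  le_antisymm D D' h h' := by
    have mono : ∀ {A B : G.DoubleDimerCover},
        Relation.ReflTransGen (fun D D' => ∃ i, G.UpTwist i D D') A B →
          (A.val.map edgeWeight).sum ≤ (B.val.map edgeWeight).sum := by
      intro A B hAB
      induction hAB with
      | refl => exact le_refl _
      | tail _ h ih => exact ih.trans h.choose_spec.weight_lt.le
    rcases Relation.ReflTransGen.cases_head h with rfl | ⟨C, ⟨i, hC⟩, hCD⟩
    · rfl
    · exact absurd (hC.weight_lt.trans_le ((mono hCD).trans (mono h'))) (lt_irrefl _)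

/-- `G` is the snake graph of the walk `w` with the same number of positions as `G` has tiles: the
second tile is to the East of the first one if and only if the first letter is direct, and three
consecutive tiles form a zigzag if and only if the two letters between them are both direct or
both inverse (they form a straight piece otherwise). -/
def IsSnakeGraphOf {Q : Type*} [Quiver Q] (w : QWalk Q) (G : SnakeGraph w.length) : Prop :=
  (∀ k : Fin w.length, k.val = 0 → (G.step k = SnakeDir.east ↔ w.direct k = true)) ∧
    ∀ k l : Fin w.length, l.val = k.val + 1 → (G.step k ≠ G.step l ↔ w.direct k = w.direct l)

end SnakeGraph

end

/-! Both lattices are identified with the lattice of height functions: functions `h` from the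
positions of `w` to `{0, 1, 2}` that increase weakly along direct letters and decrease weakly along
inverse ones, ordered pointwise.

On the module side, `h i` counts the standard basis vectors at position `i` that lie in `N`. Since
`ε` sends `z_i ⊗ 1` to `z_i ⊗ ε`, the count determines which vectors these are, and stability under
the arrows is exactly monotonicity along the letters (`isClosedSet_heightSet`,
`IsClosedSet.exists_eq_heightSet`). Hence canonical submodules are height functions
(`heightSubmoduleIso`).

On the graph side, every edge joins consecutive antidiagonals `x + y = const`, and between two of
them a double dimer cover has exactly two edges. So a cover is determined by one number `a i` per
tile: a boundary edge of the tile has multiplicity `a i` if vertical and `2 - a i` if horizontal,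
while an edge shared by two tiles has multiplicity `±(a k + a (k + 1) - 2)`, with plus for a
vertical edge (`hasWeights_inNW`, `edgeSum_glue`). Put `a i = 2 - h i` on even and `a i = h i` on
odd tiles. The shared edges then have multiplicity `±(h (k + 1) - h k)`, with plus exactly for
direct letters (`IsSnakeGraphOf.direct_iff`, `edgeSum_tileWeight_glue`), so nonnegativity of all
multiplicities says that `h` is a height function (`heightCoverIso`).

An upward twist at `i` and the addition of a single top at `i` both amount to raising `h i` by one
(`upTwist_heightCover_iff`, `addsTop_heightSubmodule_iff`). Such raises are the cover relations of
height functions and generate their order, because between `h < h'` some value of `h` can always be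
raised without exceeding `h'` (`exists_raise_le`). -/

noncomputable section

/-! ### Coordinates of tiles and unit edges -/

namespace SnakeGraph

variable {n : ℕ} (G : SnakeGraph n)

theorem step_eq_north_iff {k : Fin n} : G.step k = .north ↔ G.step k ≠ .east := by
  cases G.step k <;> simp

theorem xPos_zero : G.xPos 0 = 0 := by simp [xPos]

theorem yPos_zero : G.yPos 0 = 0 := by simp [yPos]

theorem xPos_succ (k : Fin n) :
    G.xPos k.succ = G.xPos k.castSucc + if G.step k = .east then 1 else 0 := by
  have h : (Finset.univ.filter fun j : Fin n => j.castSucc < k.succ ∧ G.step j = .east) =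
      (Finset.univ.filter fun j : Fin n => j.castSucc < k.castSucc ∧ G.step j = .east) ∪
        if G.step k = .east then {k} else ∅ := by
    ext j
    simp only [Fin.castSucc_lt_succ_iff, Fin.castSucc_lt_castSucc_iff, Finset.mem_filter,
      Finset.mem_univ, true_and, Finset.mem_union, le_iff_lt_or_eq]
    by_cases hj : j = k
    · subst hj; by_cases h : G.step j = .east <;> simp [h]
    · by_cases h : G.step k = .east <;> simp [h, hj]
  rw [xPos, h, Finset.card_union_of_disjoint]
  · rw [xPos]; split_ifs <;> simp
  · split_ifs <;> simp

theorem yPos_succ (k : Fin n) :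
    G.yPos k.succ = G.yPos k.castSucc + if G.step k = .east then 0 else 1 := by
  have h1 := G.xPos_add_yPos k.succ
  have h2 := G.xPos_add_yPos k.castSucc
  rw [xPos_succ] at h1
  simp only [Fin.val_succ, Fin.val_castSucc] at h1 h2
  split_ifs at h1 ⊢ <;> omega

/-- The horizontal unit edge starting at `(x, y)`. -/
def hEdge (x y : ℕ) : Sym2 (ℕ × ℕ) := s((x, y), (x + 1, y))

/-- The vertical unit edge starting at `(x, y)`. -/
def vEdge (x y : ℕ) : Sym2 (ℕ × ℕ) := s((x, y), (x, y + 1))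

theorem hEdge_inj {x y x' y' : ℕ} : hEdge x y = hEdge x' y' ↔ x = x' ∧ y = y' := by
  simp only [hEdge, Sym2.eq_iff, Prod.mk.injEq]; omega

theorem vEdge_inj {x y x' y' : ℕ} : vEdge x y = vEdge x' y' ↔ x = x' ∧ y = y' := by
  simp only [vEdge, Sym2.eq_iff, Prod.mk.injEq]; omega

theorem hEdge_ne_vEdge (x y x' y' : ℕ) : hEdge x y ≠ vEdge x' y' := by
  simp only [hEdge, vEdge, ne_eq, Sym2.eq_iff, Prod.mk.injEq]; omega

theorem mem_hEdge {x y a b : ℕ} : (x, y) ∈ hEdge a b ↔ y = b ∧ (x = a ∨ x = a + 1) := by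
  simp only [hEdge, Sym2.mem_iff, Prod.mk.injEq]; tauto

theorem mem_vEdge {x y a b : ℕ} : (x, y) ∈ vEdge a b ↔ x = a ∧ (y = b ∨ y = b + 1) := by
  simp only [vEdge, Sym2.mem_iff, Prod.mk.injEq]; tauto

theorem west_eq (i : Fin (n + 1)) : G.west i = vEdge (G.xPos i) (G.yPos i) := rfl
theorem east_eq (i : Fin (n + 1)) : G.east i = vEdge (G.xPos i + 1) (G.yPos i) := rfl
theorem south_eq (i : Fin (n + 1)) : G.south i = hEdge (G.xPos i) (G.yPos i) := rfl
theorem north_eq (i : Fin (n + 1)) : G.north i = hEdge (G.xPos i) (G.yPos i + 1) := rfl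

theorem hEdge_mem_tileEdges {x y : ℕ} {i : Fin (n + 1)} :
    hEdge x y ∈ G.tileEdges i ↔ x = G.xPos i ∧ (y = G.yPos i ∨ y = G.yPos i + 1) := by
  simp only [tileEdges, west_eq, east_eq, south_eq, north_eq, Set.mem_insert_iff,
    Set.mem_singleton_iff, hEdge_ne_vEdge, hEdge_inj]
  tauto

theorem vEdge_mem_tileEdges {x y : ℕ} {i : Fin (n + 1)} :
    vEdge x y ∈ G.tileEdges i ↔ y = G.yPos i ∧ (x = G.xPos i ∨ x = G.xPos i + 1) := by
  simp only [tileEdges, west_eq, east_eq, south_eq, north_eq, Set.mem_insert_iff,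
    Set.mem_singleton_iff, (hEdge_ne_vEdge _ _ _ _).symm, vEdge_inj]
  tauto

theorem exists_eq_hEdge_or_vEdge {e : Sym2 (ℕ × ℕ)} (he : e ∈ G.edges) :
    ∃ x y, e = hEdge x y ∨ e = vEdge x y := by
  obtain ⟨i, rfl | rfl | rfl | rfl⟩ := he
  exacts [⟨_, _, .inr rfl⟩, ⟨_, _, .inr rfl⟩, ⟨_, _, .inl rfl⟩, ⟨_, _, .inl rfl⟩]

theorem east_castSucc {k : Fin n} (hk : G.step k = .east) :
    G.east k.castSucc = G.west k.succ := by
  simp [east_eq, west_eq, xPos_succ, yPos_succ, hk]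

theorem north_castSucc {k : Fin n} (hk : G.step k = .north) :
    G.north k.castSucc = G.south k.succ := by
  simp [north_eq, south_eq, xPos_succ, yPos_succ, hk]

/-- The number of members of a multiset of unit edges incident to a given vertex. -/
theorem card_filter_mem (D : Multiset (Sym2 (ℕ × ℕ)))
    (hD : ∀ e ∈ D, ∃ x y, e = hEdge x y ∨ e = vEdge x y) (x y : ℕ) :
    (D.filter fun e => (x, y) ∈ e).card = D.count (hEdge x y) + D.count (vEdge x y) +
      (if 0 < x then D.count (hEdge (x - 1) y) else 0) +
      (if 0 < y then D.count (vEdge x (y - 1)) else 0) := by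
  induction D using Multiset.induction_on with
  | empty => simp
  | cons e D ih =>
    rw [Multiset.filter_cons, Multiset.card_add,
      ih fun e he => hD e (Multiset.mem_cons_of_mem he)]
    simp only [Multiset.count_cons]
    obtain ⟨a, b, rfl | rfl⟩ := hD e (Multiset.mem_cons_self _ _)
    · simp only [hEdge_inj, (hEdge_ne_vEdge _ _ _ _).symm]
      simp only [mem_hEdge, if_false, add_zero, apply_ite Multiset.card,
        Multiset.card_singleton, Multiset.card_zero]
      split_ifs <;> omega
    · simp only [vEdge_inj, hEdge_ne_vEdge]
      simp only [mem_vEdge, if_false, add_zero, apply_ite Multiset.card,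
        Multiset.card_singleton, Multiset.card_zero]
      split_ifs <;> omega

/-! ### Vertex degrees, antidiagonal by antidiagonal -/

section Degrees

variable {G} {D : Multiset (Sym2 (ℕ × ℕ))}

variable (G D) in
/-- The number of members of `D` that enter the North-West corner of a tile from the South
or from the West. -/
def inNW (i : Fin (n + 1)) : ℕ :=
  D.count (G.west i) +
    Fin.cases 0 (fun k => if G.step k = .east then D.count (G.north k.castSucc) else 0) i

variable (G D) in
/-- The number of members of `D` that enter the South-East corner of a tile from the South
or from the West. -/
def inSE (i : Fin (n + 1)) : ℕ :=
  D.count (G.south i) +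
    Fin.cases 0 (fun k => if G.step k = .east then 0 else D.count (G.east k.castSucc)) i

variable (G D) in
/-- The number of members of `D` that leave the North-West corner of a tile to the North
or to the East. -/
def outNW (i : Fin (n + 1)) : ℕ :=
  D.count (G.north i) +
    Fin.lastCases 0 (fun k => if G.step k = .east then 0 else D.count (G.west k.succ)) i

variable (G D) in
/-- The number of members of `D` that leave the South-East corner of a tile to the North
or to the East. -/
def outSE (i : Fin (n + 1)) : ℕ :=
  D.count (G.east i) +
    Fin.lastCases 0 (fun k => if G.step k = .east then D.count (G.south k.succ) else 0) i

theorem count_eq_zero_of_forall_notMem (hD : ∀ e ∈ D, e ∈ G.edges) {e : Sym2 (ℕ × ℕ)}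
    (h : ∀ i, e ∉ G.tileEdges i) : D.count e = 0 :=
  Multiset.count_eq_zero.mpr fun he => let ⟨i, hi⟩ := hD e he; h i hi

theorem card_filter_origin (hD : ∀ e ∈ D, e ∈ G.edges) :
    (D.filter fun e => (G.xPos 0, G.yPos 0) ∈ e).card =
      D.count (G.west 0) + D.count (G.south 0) := by
  rw [card_filter_mem D fun e he => exists_eq_hEdge_or_vEdge G (hD e he)]
  simp [west_eq, south_eq, xPos_zero, yPos_zero, add_comm]

/-- Each step raises exactly one coordinate, so tile `i` sits on the antidiagonal `x + y = i`. This
reduces incidence questions between tiles and edges to linear arithmetic. -/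
theorem eq_of_xPos_add_yPos {i j : Fin (n + 1)}
    (h : G.xPos i + G.yPos i = G.xPos j + G.yPos j) : i = j := by
  rw [xPos_add_yPos, xPos_add_yPos] at h
  exact Fin.ext h

/-- Of the four unit edges at this vertex, the one going up belongs to the graph only if the next
tile is glued to the North, and the one coming from the left only if the tile itself was glued to
the East. In the other cases the antidiagonal leaves only tiles with the wrong coordinates. -/
theorem card_filter_northWest (hD : ∀ e ∈ D, e ∈ G.edges) (i : Fin (n + 1)) :
    (D.filter fun e => (G.xPos i, G.yPos i + 1) ∈ e).card = G.inNW D i + G.outNW D i := by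
  rw [card_filter_mem D fun e he => exists_eq_hEdge_or_vEdge G (hD e he)]
  have h1 : D.count (vEdge (G.xPos i) (G.yPos i + 1)) = Fin.lastCases 0
      (fun k => if G.step k = .east then 0 else D.count (G.west k.succ)) i := by
    induction i using Fin.lastCases with
    | last =>
      rw [Fin.lastCases_last]
      refine count_eq_zero_of_forall_notMem hD fun j => ?_
      rw [vEdge_mem_tileEdges]
      have h2 := G.xPos_add_yPos j
      have h3 := G.xPos_add_yPos (Fin.last n)
      have := j.isLt
      simp only [Fin.val_last] at h3
      by_cases hj : j = Fin.last n
      · subst hj; omega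
      · have : j.val ≠ n := fun h => hj (Fin.ext h)
        omega
    | cast k =>
      rw [Fin.lastCases_castSucc]
      split_ifs with hk
      · refine count_eq_zero_of_forall_notMem hD fun j => ?_
        rw [vEdge_mem_tileEdges]
        rintro ⟨h2, h3⟩
        have h4 := G.xPos_succ k
        have h5 := G.yPos_succ k
        rw [if_pos hk] at h4 h5
        rcases h3 with h3 | h3
        · have : j = k.succ := eq_of_xPos_add_yPos (G := G) (by omega)
          subst this; omega
        · have : j = k.castSucc := eq_of_xPos_add_yPos (G := G) (by omega)
          subst this; omega
      · rw [west_eq, xPos_succ, yPos_succ, if_neg hk, if_neg hk, add_zero]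
  have h2 : (if 0 < G.xPos i then D.count (hEdge (G.xPos i - 1) (G.yPos i + 1)) else 0) =
      Fin.cases 0 (fun k => if G.step k = .east then D.count (G.north k.castSucc) else 0) i := by
    induction i using Fin.cases with
    | zero => rw [Fin.cases_zero, xPos_zero]; simp
    | succ k =>
      rw [Fin.cases_succ]
      have h4 := G.xPos_succ k
      have h5 := G.yPos_succ k
      split_ifs with hx hk hk
      · rw [if_pos hk] at h4 h5
        rw [north_eq, h4, h5]; simp
      · rw [if_neg hk] at h4 h5
        refine count_eq_zero_of_forall_notMem hD fun j => ?_
        rw [hEdge_mem_tileEdges]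
        rintro ⟨h2, h3 | h3⟩
        · have : j = k.succ := eq_of_xPos_add_yPos (G := G) (by omega)
          subst this; omega
        · have : j = k.castSucc := eq_of_xPos_add_yPos (G := G) (by omega)
          subst this; omega
      · rw [if_pos hk] at h4; omega
      · rfl
  rw [h1, h2, inNW, outNW, if_pos (Nat.succ_pos _), Nat.add_sub_cancel, ← west_eq, ← north_eq]
  omega

theorem card_filter_southEast (hD : ∀ e ∈ D, e ∈ G.edges) (i : Fin (n + 1)) :
    (D.filter fun e => (G.xPos i + 1, G.yPos i) ∈ e).card = G.inSE D i + G.outSE D i := by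
  rw [card_filter_mem D fun e he => exists_eq_hEdge_or_vEdge G (hD e he)]
  have h1 : D.count (hEdge (G.xPos i + 1) (G.yPos i)) = Fin.lastCases 0
      (fun k => if G.step k = .east then D.count (G.south k.succ) else 0) i := by
    induction i using Fin.lastCases with
    | last =>
      rw [Fin.lastCases_last]
      refine count_eq_zero_of_forall_notMem hD fun j => ?_
      rw [hEdge_mem_tileEdges]
      have h2 := G.xPos_add_yPos j
      have h3 := G.xPos_add_yPos (Fin.last n)
      have := j.isLt
      simp only [Fin.val_last] at h3
      by_cases hj : j = Fin.last n
      · subst hj; omega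
      · have : j.val ≠ n := fun h => hj (Fin.ext h)
        omega
    | cast k =>
      rw [Fin.lastCases_castSucc]
      split_ifs with hk
      · rw [south_eq, xPos_succ, yPos_succ, if_pos hk, if_pos hk, add_zero]
      · refine count_eq_zero_of_forall_notMem hD fun j => ?_
        rw [hEdge_mem_tileEdges]
        rintro ⟨h2, h3⟩
        have h4 := G.xPos_succ k
        have h5 := G.yPos_succ k
        rw [if_neg hk] at h4 h5
        rcases h3 with h3 | h3
        · have : j = k.succ := eq_of_xPos_add_yPos (G := G) (by omega)
          subst this; omega
        · have : j = k.castSucc := eq_of_xPos_add_yPos (G := G) (by omega)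
          subst this; omega
  have h2 : (if 0 < G.yPos i then D.count (vEdge (G.xPos i + 1) (G.yPos i - 1)) else 0) =
      Fin.cases 0 (fun k => if G.step k = .east then 0 else D.count (G.east k.castSucc)) i := by
    induction i using Fin.cases with
    | zero => rw [Fin.cases_zero, yPos_zero]; simp
    | succ k =>
      rw [Fin.cases_succ]
      have h4 := G.xPos_succ k
      have h5 := G.yPos_succ k
      split_ifs with hx hk hk
      · rw [if_pos hk] at h4 h5
        refine count_eq_zero_of_forall_notMem hD fun j => ?_
        rw [vEdge_mem_tileEdges]
        rintro ⟨h2, h3 | h3⟩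
        · have : j = k.succ := eq_of_xPos_add_yPos (G := G) (by omega)
          subst this; omega
        · have : j = k.castSucc := eq_of_xPos_add_yPos (G := G) (by omega)
          subst this; omega
      · rw [if_neg hk] at h4 h5
        rw [east_eq, h4, h5]; simp
      · rfl
      · rw [if_neg hk] at h5; omega
  rw [h1, h2, inSE, outSE, if_pos (Nat.succ_pos _), Nat.add_sub_cancel, ← east_eq, ← south_eq]
  omega

theorem card_filter_corner (hD : ∀ e ∈ D, e ∈ G.edges) :
    (D.filter fun e => (G.xPos (Fin.last n) + 1, G.yPos (Fin.last n) + 1) ∈ e).card =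
      D.count (G.north (Fin.last n)) + D.count (G.east (Fin.last n)) := by
  rw [card_filter_mem D fun e he => exists_eq_hEdge_or_vEdge G (hD e he)]
  have h3 := G.xPos_add_yPos (Fin.last n)
  have h1 : D.count (hEdge (G.xPos (Fin.last n) + 1) (G.yPos (Fin.last n) + 1)) = 0 := by
    refine count_eq_zero_of_forall_notMem hD fun j => ?_
    rw [hEdge_mem_tileEdges]
    have h2 := G.xPos_add_yPos j
    have := j.isLt
    simp only [Fin.val_last] at h3
    omega
  have h2 : D.count (vEdge (G.xPos (Fin.last n) + 1) (G.yPos (Fin.last n) + 1)) = 0 := by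
    refine count_eq_zero_of_forall_notMem hD fun j => ?_
    rw [vEdge_mem_tileEdges]
    have h2 := G.xPos_add_yPos j
    have := j.isLt
    simp only [Fin.val_last] at h3
    omega
  rw [h1, h2, if_pos (Nat.succ_pos _), if_pos (Nat.succ_pos _), Nat.add_sub_cancel,
    Nat.add_sub_cancel, ← east_eq, ← north_eq]
  omega

-- The South-West corner of a later tile is the South-East or North-West corner of its predecessor,
-- and dually for North-East corners. So only the two extreme corners need to be listed separately.
variable (G) in
theorem mem_vertices_iff {v : ℕ × ℕ} : v ∈ G.vertices ↔ v = (G.xPos 0, G.yPos 0) ∨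
    (∃ i, v = (G.xPos i, G.yPos i + 1)) ∨ (∃ i, v = (G.xPos i + 1, G.yPos i)) ∨
    v = (G.xPos (Fin.last n) + 1, G.yPos (Fin.last n) + 1) := by
  constructor
  · have hsw : ∀ i, v = (G.xPos i, G.yPos i) → v = (G.xPos 0, G.yPos 0) ∨
        (∃ i, v = (G.xPos i, G.yPos i + 1)) ∨ ∃ i, v = (G.xPos i + 1, G.yPos i) := by
      intro i hi
      induction i using Fin.cases with
      | zero => exact .inl hi
      | succ k =>
        rw [xPos_succ, yPos_succ] at hi
        split_ifs at hi
        exacts [.inr (.inr ⟨_, hi⟩), .inr (.inl ⟨_, hi⟩)]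
    have hne : ∀ i, v = (G.xPos i + 1, G.yPos i + 1) →
        (∃ i, v = (G.xPos i, G.yPos i + 1)) ∨ (∃ i, v = (G.xPos i + 1, G.yPos i)) ∨
        v = (G.xPos (Fin.last n) + 1, G.yPos (Fin.last n) + 1) := by
      intro i hi
      induction i using Fin.lastCases with
      | last => exact .inr (.inr hi)
      | cast k =>
        have h4 := G.xPos_succ k
        have h5 := G.yPos_succ k
        split_ifs at h4 h5
        · exact .inl ⟨k.succ, by rw [hi, h4, h5]⟩
        · exact .inr (.inl ⟨k.succ, by rw [hi, h4, h5]⟩)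
    rintro ⟨e, ⟨i, rfl | rfl | rfl | rfl⟩, hv⟩ <;>
      rcases Sym2.mem_iff.mp hv with h | h
    all_goals first
      | have := hsw i h; tauto
      | have := hne i h; tauto
      | exact .inr (.inl ⟨i, h⟩)
      | exact .inr (.inr (.inl ⟨i, h⟩))
  · rintro (rfl | ⟨i, rfl⟩ | ⟨i, rfl⟩ | rfl)
    · exact ⟨G.west 0, ⟨0, .inl rfl⟩, Sym2.mem_mk_left _ _⟩
    · exact ⟨G.west i, ⟨i, .inl rfl⟩, Sym2.mem_mk_right _ _⟩
    · exact ⟨G.east i, ⟨i, .inr (.inl rfl)⟩, Sym2.mem_mk_left _ _⟩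
    · exact ⟨G.east _, ⟨_, .inr (.inl rfl)⟩, Sym2.mem_mk_right _ _⟩

/-- A multiset of edges of a snake graph is a double dimer cover if and only if all edges that
enter or leave the corners of the tiles add up to two. -/
theorem forall_card_filter_eq_two_iff (hD : ∀ e ∈ D, e ∈ G.edges) :
    (∀ v ∈ G.vertices, (D.filter fun e => v ∈ e).card = 2) ↔
      D.count (G.west 0) + D.count (G.south 0) = 2 ∧
      (∀ i, G.inNW D i + G.outNW D i = 2) ∧ (∀ i, G.inSE D i + G.outSE D i = 2) ∧
      D.count (G.north (Fin.last n)) + D.count (G.east (Fin.last n)) = 2 := by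
  simp only [← card_filter_origin hD, ← card_filter_northWest hD, ← card_filter_southEast hD,
    ← card_filter_corner hD]
  constructor
  · intro h
    exact ⟨h _ (G.mem_vertices_iff.mpr (.inl rfl)),
      fun i => h _ (G.mem_vertices_iff.mpr (.inr (.inl ⟨i, rfl⟩))),
      fun i => h _ (G.mem_vertices_iff.mpr (.inr (.inr (.inl ⟨i, rfl⟩)))),
      h _ (G.mem_vertices_iff.mpr (.inr (.inr (.inr rfl))))⟩
  · rintro ⟨h1, h2, h3, h4⟩ v hv
    rw [mem_vertices_iff] at hv
    rcases hv with rfl | ⟨i, rfl⟩ | ⟨i, rfl⟩ | rfl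
    exacts [h1, h2 i, h3 i, h4]

end Degrees

/-! ### Covers are determined by tile weights -/

/-- The values of a function on the edges are those prescribed by the weights `a i` of the
vertical and `2 - a i` of the horizontal edges of the tiles. -/
structure HasWeights (c : Sym2 (ℕ × ℕ) → ℤ) (a : Fin (n + 1) → ℤ) : Prop where
  west_zero : c (G.west 0) = a 0
  south_zero : c (G.south 0) = 2 - a 0
  north_last : c (G.north (Fin.last n)) = 2 - a (Fin.last n)
  east_last : c (G.east (Fin.last n)) = a (Fin.last n)
  south_succ : ∀ k, G.step k = .east → c (G.south k.succ) = 2 - a k.succ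
  north_castSucc : ∀ k, G.step k = .east →
    c (G.north k.castSucc) = 2 - a k.castSucc
  west_succ_east : ∀ k, G.step k = .east →
    c (G.west k.succ) = a k.castSucc + a k.succ - 2
  west_succ : ∀ k, G.step k ≠ .east → c (G.west k.succ) = a k.succ
  east_castSucc : ∀ k, G.step k ≠ .east → c (G.east k.castSucc) = a k.castSucc
  south_succ_north : ∀ k, G.step k ≠ .east →
    c (G.south k.succ) = 2 - a k.castSucc - a k.succ

variable {G} {D : Multiset (Sym2 (ℕ × ℕ))} {a : Fin (n + 1) → ℤ}

theorem HasWeights.inNW_eq (h : G.HasWeights (fun e => D.count e) a) (i : Fin (n + 1)) :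
    (G.inNW D i : ℤ) = a i := by
  rw [inNW]
  induction i using Fin.cases with
  | zero => simp [h.west_zero]
  | succ k =>
    by_cases hk : G.step k = .east
    · simp [hk, h.west_succ_east, h.north_castSucc]
    · simp [hk, h.west_succ]

theorem HasWeights.inSE_eq (h : G.HasWeights (fun e => D.count e) a) (i : Fin (n + 1)) :
    (G.inSE D i : ℤ) = 2 - a i := by
  rw [inSE]
  induction i using Fin.cases with
  | zero => simp [h.south_zero]
  | succ k =>
    by_cases hk : G.step k = .east
    · simp [hk, h.south_succ]
    · simp [hk, h.south_succ_north, h.east_castSucc]; ring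

theorem HasWeights.outNW_eq (h : G.HasWeights (fun e => D.count e) a) (i : Fin (n + 1)) :
    (G.outNW D i : ℤ) = 2 - a i := by
  rw [outNW]
  induction i using Fin.lastCases with
  | last => simp [h.north_last]
  | cast k =>
    by_cases hk : G.step k = .east
    · simp [hk, h.north_castSucc]
    · rw [SnakeGraph.north_castSucc G (G.step_eq_north_iff.mpr hk)]
      simp [hk, h.south_succ_north, h.west_succ]

theorem HasWeights.outSE_eq (h : G.HasWeights (fun e => D.count e) a) (i : Fin (n + 1)) :
    (G.outSE D i : ℤ) = a i := by
  rw [outSE]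
  induction i using Fin.lastCases with
  | last => simp [h.east_last]
  | cast k =>
    by_cases hk : G.step k = .east
    · rw [SnakeGraph.east_castSucc G hk]
      simp [hk, h.south_succ, h.west_succ_east]
    · simp [hk, h.east_castSucc]

theorem HasWeights.card_filter (h : G.HasWeights (fun e => D.count e) a) (hD : ∀ e ∈ D, e ∈ G.edges) :
    ∀ v ∈ G.vertices, (D.filter fun e => v ∈ e).card = 2 := by
  refine (forall_card_filter_eq_two_iff hD).mpr ⟨?_, fun i => ?_, fun i => ?_, ?_⟩
  · have h1 : (D.count _ : ℤ) = _ := h.west_zero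
    have h2 : (D.count _ : ℤ) = _ := h.south_zero
    omega
  · have h1 := h.inNW_eq i
    have h2 := h.outNW_eq i
    omega
  · have h1 := h.inSE_eq i
    have h2 := h.outSE_eq i
    omega
  · have h1 : (D.count _ : ℤ) = _ := h.north_last
    have h2 : (D.count _ : ℤ) = _ := h.east_last
    omega

/-- The antidiagonal `x + y = i + 1` meets the graph in the North-West and South-East corners of
tile `i`, of total degree 4. Two members of `D` leave the origin; if two members enter an
antidiagonal, then two leave it. This is `key`, and the vertex equations then give the multiplicity
of each edge. -/
theorem hasWeights_inNW (hD : ∀ e ∈ D, e ∈ G.edges)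
    (h : ∀ v ∈ G.vertices, (D.filter fun e => v ∈ e).card = 2) :
    G.HasWeights (fun e => D.count e) fun i => G.inNW D i := by
  obtain ⟨h0, hNW, hSE, hn⟩ := (forall_card_filter_eq_two_iff hD).mp h
  have key : ∀ i, G.inNW D i + G.inSE D i = 2 := by
    intro i
    induction i using Fin.induction with
    | zero => simpa [inNW, inSE] using h0
    | succ k ih =>
      have h1 := hNW k.castSucc
      have h2 := hSE k.castSucc
      rw [outNW, Fin.lastCases_castSucc] at h1
      rw [outSE, Fin.lastCases_castSucc] at h2
      rw [inNW, inSE, Fin.cases_succ, Fin.cases_succ]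
      split_ifs at h1 h2 ⊢ with hk
      · rw [SnakeGraph.east_castSucc G hk] at h2; omega
      · rw [SnakeGraph.north_castSucc G (G.step_eq_north_iff.mpr hk)] at h1; omega
  have hl := hNW (Fin.last n)
  have hl' := hSE (Fin.last n)
  have hkeyl := key (Fin.last n)
  have e0 : G.inNW D 0 = D.count (G.west 0) := by simp [inNW]
  simp only [outNW, outSE, Fin.lastCases_last] at hl hl'
  have hk (k : Fin n) : _ ∧ _ ∧ _ ∧ _ := ⟨key k.castSucc, key k.succ, hNW k.castSucc, hSE k.castSucc⟩
  have eNW (k : Fin n) : G.inNW D k.succ = D.count (G.west k.succ) +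
    if G.step k = .east then D.count (G.north k.castSucc) else 0 := rfl
  have eSE (k : Fin n) : G.inSE D k.succ = D.count (G.south k.succ) +
    if G.step k = .east then 0 else D.count (G.east k.castSucc) := rfl
  simp only [outNW, outSE, Fin.lastCases_castSucc] at hk
  refine ⟨?_, ?_, ?_, ?_, fun k hs => ?_, fun k hs => ?_, fun k hs => ?_, fun k hs => ?_,
    fun k hs => ?_, fun k hs => ?_⟩
  iterate 4 omega
  all_goals
    replace hk := hk k
    replace eNW := eNW k
    replace eSE := eSE k
    simp only [hs, if_true, if_false] at hk eNW eSE
    omega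

end SnakeGraph

/-! ### Edge multiplicities as an affine function of tile weights -/

namespace SnakeGraph

section EdgeSum

variable {n : ℕ} (G : SnakeGraph n)

open Classical in
/-- The weight of an edge of a tile: `a i` for a vertical and `2 - a i` for a horizontal edge. -/
def sideWeight (a : Fin (n + 1) → ℤ) (i : Fin (n + 1)) (e : Sym2 (ℕ × ℕ)) : ℤ :=
  if e = G.west i ∨ e = G.east i then a i else 2 - a i

open Classical in
/-- The multiplicity of an edge that belongs to tiles with given weights. -/
def edgeSum (a : Fin (n + 1) → ℤ) (e : Sym2 (ℕ × ℕ)) : ℤ :=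
  2 + ∑ i, if e ∈ G.tileEdges i then G.sideWeight a i e - 2 else 0

theorem sideWeight_hEdge (a : Fin (n + 1) → ℤ) (i : Fin (n + 1)) (x y : ℕ) :
    G.sideWeight a i (hEdge x y) = 2 - a i := by
  simp [sideWeight, west_eq, east_eq, hEdge_ne_vEdge]

theorem sideWeight_vEdge (a : Fin (n + 1) → ℤ) {i : Fin (n + 1)} {x y : ℕ}
    (h : vEdge x y ∈ G.tileEdges i) : G.sideWeight a i (vEdge x y) = a i := by
  rw [vEdge_mem_tileEdges] at h
  rw [sideWeight, if_pos]
  simp only [west_eq, east_eq, vEdge_inj]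
  tauto

/-- The edge shared by two consecutive tiles. -/
def glue (k : Fin n) : Sym2 (ℕ × ℕ) :=
  if G.step k = .east then G.west k.succ else G.south k.succ

variable {G}

theorem edgeSum_of_unique (a : Fin (n + 1) → ℤ) {e : Sym2 (ℕ × ℕ)} {i : Fin (n + 1)}
    (hi : e ∈ G.tileEdges i) (h : ∀ j, e ∈ G.tileEdges j → j = i) :
    G.edgeSum a e = G.sideWeight a i e := by
  rw [edgeSum, Finset.sum_eq_single i, if_pos hi]
  · ring
  · intro j _ hj
    exact if_neg fun h' => hj (h j h')
  · simp

/-- A unit edge can only be a side of the two squares adjacent to it, and these lie on consecutive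
antidiagonals, each of which carries at most one tile. -/
theorem glue_mem_tileEdges_iff {k : Fin n} {j : Fin (n + 1)} :
    G.glue k ∈ G.tileEdges j ↔ j = k.castSucc ∨ j = k.succ := by
  have h1 := G.xPos_succ k
  have h2 := G.yPos_succ k
  rw [glue]
  split_ifs at h1 h2 ⊢ with hk
  · rw [west_eq, vEdge_mem_tileEdges]
    constructor
    · rintro ⟨h3, h4 | h4⟩
      · exact .inr (eq_of_xPos_add_yPos (G := G) (by omega))
      · exact .inl (eq_of_xPos_add_yPos (G := G) (by omega))
    · rintro (rfl | rfl) <;> omega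
  · rw [south_eq, hEdge_mem_tileEdges]
    constructor
    · rintro ⟨h3, h4 | h4⟩
      · exact .inr (eq_of_xPos_add_yPos (G := G) (by omega))
      · exact .inl (eq_of_xPos_add_yPos (G := G) (by omega))
    · rintro (rfl | rfl) <;> omega

/-- The constants in `edgeSum` are chosen so that one tile contributes its own side weight, and two
tiles contribute the sum of their side weights minus 2. -/
theorem edgeSum_glue (a : Fin (n + 1) → ℤ) (k : Fin n) : G.edgeSum a (G.glue k) =
    if G.step k = .east then a k.castSucc + a k.succ - 2 else 2 - a k.castSucc - a k.succ := by
  have hne : k.castSucc ≠ k.succ := k.castSucc_lt_succ.ne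
  rw [edgeSum, Finset.sum_eq_add k.castSucc k.succ hne]
  · have h1 : G.glue k ∈ G.tileEdges k.castSucc := glue_mem_tileEdges_iff.mpr (.inl rfl)
    have h2 : G.glue k ∈ G.tileEdges k.succ := glue_mem_tileEdges_iff.mpr (.inr rfl)
    rw [if_pos h1, if_pos h2]
    rw [glue] at h1 h2 ⊢
    split_ifs at h1 h2 ⊢
    · rw [west_eq] at h1 h2 ⊢
      rw [G.sideWeight_vEdge _ h1, G.sideWeight_vEdge _ h2]; ring
    · rw [south_eq, sideWeight_hEdge, sideWeight_hEdge]; ring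
  · rintro j - ⟨h1, h2⟩
    exact if_neg fun h => (glue_mem_tileEdges_iff.mp h).elim h1 h2
  · simp
  · simp

/-- An edge that belongs to two tiles is the edge shared by two consecutive tiles. -/
theorem exists_eq_glue_of_lt {e : Sym2 (ℕ × ℕ)} {i j : Fin (n + 1)} (hi : e ∈ G.tileEdges i)
    (hj : e ∈ G.tileEdges j) (hij : i < j) : ∃ k : Fin n, e = G.glue k := by
  have h1 := G.xPos_add_yPos i
  have h2 := G.xPos_add_yPos j
  rw [Fin.lt_def] at hij
  have hjn := j.isLt
  refine ⟨⟨i.val, by omega⟩, ?_⟩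
  set k : Fin n := ⟨i.val, by omega⟩ with hk
  have hki : k.castSucc = i := rfl
  have h3 := G.xPos_succ k
  have h4 := G.yPos_succ k
  rw [hki] at h3 h4
  have hkj : k.succ = j := by
    apply Fin.ext
    rw [Fin.val_succ, hk]
    obtain ⟨x, y, rfl | rfl⟩ := exists_eq_hEdge_or_vEdge G ⟨i, hi⟩
    · rw [hEdge_mem_tileEdges] at hi hj; dsimp only; omega
    · rw [vEdge_mem_tileEdges] at hi hj; dsimp only; omega
  rw [hkj] at h3 h4
  rw [glue, hkj]
  obtain ⟨x, y, rfl | rfl⟩ := exists_eq_hEdge_or_vEdge G ⟨i, hi⟩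
  · rw [hEdge_mem_tileEdges] at hi hj
    split_ifs at h3 h4 ⊢
    · omega
    · rw [south_eq, hEdge_inj]; omega
  · rw [vEdge_mem_tileEdges] at hi hj
    split_ifs at h3 h4 ⊢
    · rw [west_eq, vEdge_inj]; omega
    · omega

/-- An edge of a tile is either a boundary edge or shared with a neighbouring tile. -/
theorem unique_or_eq_glue {e : Sym2 (ℕ × ℕ)} {i : Fin (n + 1)} (hi : e ∈ G.tileEdges i) :
    (∀ j, e ∈ G.tileEdges j → j = i) ∨ ∃ k, e = G.glue k := by
  by_contra! h
  obtain ⟨⟨j, hj, hne⟩, h⟩ := h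
  rcases lt_or_gt_of_ne hne with hlt | hlt
  · exact (exists_eq_glue_of_lt hj hi hlt).elim h
  · exact (exists_eq_glue_of_lt hi hj hlt).elim h

theorem not_isBoundary_glue (k : Fin n) : ¬ G.IsBoundary (G.glue k) := fun h =>
  k.castSucc_lt_succ.ne (h.unique (glue_mem_tileEdges_iff.mpr (.inl rfl))
    (glue_mem_tileEdges_iff.mpr (.inr rfl)))

theorem exists_eq_glue_of_not_isBoundary {e : Sym2 (ℕ × ℕ)} (he : e ∈ G.edges)
    (hb : ¬ G.IsBoundary e) : ∃ k, e = G.glue k := by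
  obtain ⟨i, hi⟩ := he
  exact (unique_or_eq_glue hi).resolve_left fun h => hb ⟨i, hi, h⟩

theorem glue_mem_edges (k : Fin n) : G.glue k ∈ G.edges :=
  ⟨_, glue_mem_tileEdges_iff.mpr (.inl rfl)⟩

theorem edgeSum_vEdge (a : Fin (n + 1) → ℤ) {i : Fin (n + 1)} {x y : ℕ}
    (hi : vEdge x y ∈ G.tileEdges i) (h : ∀ k, vEdge x y ≠ G.glue k) :
    G.edgeSum a (vEdge x y) = a i := by
  rw [edgeSum_of_unique a hi ((unique_or_eq_glue hi).resolve_right (by simpa using h)),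
    sideWeight_vEdge _ _ hi]

theorem edgeSum_hEdge (a : Fin (n + 1) → ℤ) {i : Fin (n + 1)} {x y : ℕ}
    (hi : hEdge x y ∈ G.tileEdges i) (h : ∀ k, hEdge x y ≠ G.glue k) :
    G.edgeSum a (hEdge x y) = 2 - a i := by
  rw [edgeSum_of_unique a hi ((unique_or_eq_glue hi).resolve_right (by simpa using h)),
    sideWeight_hEdge]

theorem west_ne_glue {i : Fin (n + 1)} (h : ∀ k, i = k.succ → G.step k ≠ .east) (k : Fin n) :
    G.west i ≠ G.glue k := by
  rw [glue]
  split_ifs with hk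
  · rw [west_eq, west_eq, Ne, vEdge_inj]
    exact fun h' => h k (eq_of_xPos_add_yPos (G := G) (by omega)) hk
  · exact (hEdge_ne_vEdge _ _ _ _).symm

theorem south_ne_glue {i : Fin (n + 1)} (h : ∀ k, i = k.succ → G.step k = .east) (k : Fin n) :
    G.south i ≠ G.glue k := by
  rw [glue]
  split_ifs with hk
  · exact hEdge_ne_vEdge _ _ _ _
  · rw [south_eq, south_eq, Ne, hEdge_inj]
    exact fun h' => hk (h k (eq_of_xPos_add_yPos (G := G) (by omega)))

theorem east_ne_glue {i : Fin (n + 1)} (h : ∀ k, i = k.castSucc → G.step k ≠ .east) (k : Fin n) :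
    G.east i ≠ G.glue k := by
  rw [glue]
  split_ifs with hk
  · rw [← SnakeGraph.east_castSucc G hk, east_eq, east_eq, Ne, vEdge_inj]
    exact fun h' => h k (eq_of_xPos_add_yPos (G := G) (by omega)) hk
  · exact (hEdge_ne_vEdge _ _ _ _).symm

theorem north_ne_glue {i : Fin (n + 1)} (h : ∀ k, i = k.castSucc → G.step k = .east)
    (k : Fin n) : G.north i ≠ G.glue k := by
  rw [glue]
  split_ifs with hk
  · exact hEdge_ne_vEdge _ _ _ _
  · rw [← SnakeGraph.north_castSucc G (G.step_eq_north_iff.mpr hk), north_eq, north_eq, Ne,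
      hEdge_inj]
    exact fun h' => hk (h k (eq_of_xPos_add_yPos (G := G) (by omega)))

theorem hasWeights_edgeSum (a : Fin (n + 1) → ℤ) : G.HasWeights (G.edgeSum a) a where
  west_zero := edgeSum_vEdge a (.inl rfl)
    (west_ne_glue fun k h => absurd h (Fin.succ_ne_zero k).symm)
  south_zero := edgeSum_hEdge a (.inr (.inr (.inl rfl)))
    (south_ne_glue fun k h => absurd h (Fin.succ_ne_zero k).symm)
  north_last := edgeSum_hEdge a (.inr (.inr (.inr rfl)))
    (north_ne_glue fun k h => absurd h k.castSucc_lt_last.ne')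
  east_last := edgeSum_vEdge a (.inr (.inl rfl))
    (east_ne_glue fun k h => absurd h k.castSucc_lt_last.ne')
  south_succ k hk := edgeSum_hEdge a (.inr (.inr (.inl rfl)))
    (south_ne_glue fun l h => Fin.succ_injective _ h ▸ hk)
  north_castSucc k hk := edgeSum_hEdge a (.inr (.inr (.inr rfl)))
    (north_ne_glue fun l h => Fin.castSucc_injective _ h ▸ hk)
  west_succ_east k hk := by
    have h := edgeSum_glue (G := G) a k
    rwa [glue, if_pos hk, if_pos hk] at h
  west_succ k hk := edgeSum_vEdge a (.inl rfl)
    (west_ne_glue fun l h => Fin.succ_injective _ h ▸ hk)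
  east_castSucc k hk := edgeSum_vEdge a (.inr (.inl rfl))
    (east_ne_glue fun l h => Fin.castSucc_injective _ h ▸ hk)
  south_succ_north k hk := by
    have h := edgeSum_glue (G := G) a k
    rwa [glue, if_neg hk, if_neg hk] at h

/-- The ten equations cover all edges once an East or North edge shared with the next tile is
renamed as the West or South edge of that tile. The restriction to `G.edges` matters: off the graph
`edgeSum` takes the value 2. -/
theorem HasWeights.eq_of_mem {c c' : Sym2 (ℕ × ℕ) → ℤ} {a : Fin (n + 1) → ℤ}
    (h : G.HasWeights c a) (h' : G.HasWeights c' a) {e : Sym2 (ℕ × ℕ)} (he : e ∈ G.edges) :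
    c e = c' e := by
  have hw (i) : c (G.west i) = c' (G.west i) := by
    induction i using Fin.cases with
    | zero => rw [h.west_zero, h'.west_zero]
    | succ k =>
      by_cases hk : G.step k = .east
      · rw [h.west_succ_east k hk, h'.west_succ_east k hk]
      · rw [h.west_succ k hk, h'.west_succ k hk]
  have hs (i) : c (G.south i) = c' (G.south i) := by
    induction i using Fin.cases with
    | zero => rw [h.south_zero, h'.south_zero]
    | succ k =>
      by_cases hk : G.step k = .east
      · rw [h.south_succ k hk, h'.south_succ k hk]
      · rw [h.south_succ_north k hk, h'.south_succ_north k hk]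
  obtain ⟨i, rfl | rfl | rfl | rfl⟩ := he
  · exact hw i
  · induction i using Fin.lastCases with
    | last => rw [h.east_last, h'.east_last]
    | cast k =>
      by_cases hk : G.step k = .east
      · rw [SnakeGraph.east_castSucc G hk, hw]
      · rw [h.east_castSucc k hk, h'.east_castSucc k hk]
  · exact hs i
  · induction i using Fin.lastCases with
    | last => rw [h.north_last, h'.north_last]
    | cast k =>
      by_cases hk : G.step k = .east
      · rw [h.north_castSucc k hk, h'.north_castSucc k hk]
      · rw [SnakeGraph.north_castSucc G (G.step_eq_north_iff.mpr hk), hs]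

theorem HasWeights.congr {c c' : Sym2 (ℕ × ℕ) → ℤ} {a : Fin (n + 1) → ℤ}
    (h : G.HasWeights c a) (hc : ∀ e ∈ G.edges, c' e = c e) : G.HasWeights c' a := by
  have hw (i) : c' (G.west i) = c (G.west i) := hc _ ⟨i, .inl rfl⟩
  have he (i) : c' (G.east i) = c (G.east i) := hc _ ⟨i, .inr (.inl rfl)⟩
  have hs (i) : c' (G.south i) = c (G.south i) := hc _ ⟨i, .inr (.inr (.inl rfl))⟩
  have hn (i) : c' (G.north i) = c (G.north i) := hc _ ⟨i, .inr (.inr (.inr rfl))⟩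
  constructor <;> simp only [hw, he, hs, hn]
  exacts [h.west_zero, h.south_zero, h.north_last, h.east_last, h.south_succ, h.north_castSucc,
    h.west_succ_east, h.west_succ, h.east_castSucc, h.south_succ_north]

/-- Only the summand of tile `i` depends on `a i`, with slope 1 on vertical and -1 on horizontal
sides. For a change by one this is the effect of a twist. -/
theorem edgeSum_update (a : Fin (n + 1) → ℤ) (i : Fin (n + 1)) (v : ℤ) (e : Sym2 (ℕ × ℕ)) :
    G.edgeSum (Function.update a i v) e = G.edgeSum a e +
      ((if e = G.west i then v - a i else 0) + (if e = G.east i then v - a i else 0) -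
       (if e = G.south i then v - a i else 0) - (if e = G.north i then v - a i else 0)) := by
  classical
  have key (j) : (if e ∈ G.tileEdges j then G.sideWeight (Function.update a i v) j e - 2 else 0) =
      (if e ∈ G.tileEdges j then G.sideWeight a j e - 2 else 0) + if j = i then
        ((if e = G.west i then v - a i else 0) + (if e = G.east i then v - a i else 0) -
        (if e = G.south i then v - a i else 0) - (if e = G.north i then v - a i else 0)) else 0 := by
    by_cases hj : j = i
    · subst hj
      have h1 : G.west j ≠ G.south j := (hEdge_ne_vEdge _ _ _ _).symm
      have h2 : G.west j ≠ G.north j := (hEdge_ne_vEdge _ _ _ _).symm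
      have h3 : G.east j ≠ G.south j := (hEdge_ne_vEdge _ _ _ _).symm
      have h4 : G.east j ≠ G.north j := (hEdge_ne_vEdge _ _ _ _).symm
      have h5 : G.west j ≠ G.east j := by rw [west_eq, east_eq, Ne, vEdge_inj]; omega
      have h6 : G.south j ≠ G.north j := by rw [south_eq, north_eq, Ne, hEdge_inj]; omega
      simp only [tileEdges, Set.mem_insert_iff, Set.mem_singleton_iff, sideWeight,
        Function.update_self, if_true]
      by_cases e1 : e = G.west j
      · subst e1; simp [h1, h2, h5]
      by_cases e2 : e = G.east j
      · subst e2; simp [h3, h4, h5.symm]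
      by_cases e3 : e = G.south j
      · subst e3; simp [h1.symm, h3.symm, h6]; ring
      by_cases e4 : e = G.north j
      · subst e4; simp [h2.symm, h4.symm, h6.symm]; ring
      simp [e1, e2, e3, e4]
    · simp [sideWeight, hj]
  rw [edgeSum, Finset.sum_congr rfl fun j _ => key j, Finset.sum_add_distrib,
    Finset.sum_ite_eq' Finset.univ i, if_pos (Finset.mem_univ i), edgeSum]
  ring

end EdgeSum

end SnakeGraph

/-! ### Height functions -/

/-- A function on the positions of a walk with values in `{0, 1, 2}` that increases weakly along
direct letters and decreases weakly along inverse letters. -/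
def IsHeight {n : ℕ} (d : Fin n → Bool) (h : Fin (n + 1) → ℕ) : Prop :=
  (∀ i, h i ≤ 2) ∧
    ∀ k, if d k = true then h k.castSucc ≤ h k.succ else h k.succ ≤ h k.castSucc

/-- The height functions, ordered pointwise. -/
abbrev HeightFunction {n : ℕ} (d : Fin n → Bool) : Type :=
  {h : Fin (n + 1) → ℕ // IsHeight d h}

namespace HeightFunction

variable {n : ℕ} {d : Fin n → Bool}

/-- `h'` arises from `h` by increasing the value at `i` by one. -/
def Raise (i : Fin (n + 1)) (h h' : HeightFunction d) : Prop :=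
  h'.val = Function.update h.val i (h.val i + 1)

theorem Raise.lt {i : Fin (n + 1)} {h h' : HeightFunction d} (H : Raise i h h') : h < h' := by
  change h.val < h'.val
  rw [show h'.val = _ from H]
  exact lt_update_self_iff.mpr (Nat.lt_succ_self _)

/-- Anything in between agrees with `h` away from `i`, and at `i` there is no integer strictly
between consecutive ones. -/
theorem Raise.covBy {i : Fin (n + 1)} {h h' : HeightFunction d} (H : Raise i h h') : h ⋖ h' := by
  refine ⟨H.lt, fun g hg hg' => ?_⟩
  have hH : h'.val = _ := H
  have h1 : ∀ j, h.val j ≤ g.val j := fun j => hg.le j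
  have h2 : ∀ j, g.val j ≤ h'.val j := fun j => hg'.le j
  have hne : ∀ j, j ≠ i → g.val j = h.val j := fun j hj =>
    le_antisymm (by simpa [hH, hj] using h2 j) (h1 j)
  have hi := h2 i
  rw [hH, Function.update_self] at hi
  rcases hi.lt_or_eq with hi | hi
  · refine hg.not_ge fun j => ?_
    by_cases hj : j = i
    · subst hj; exact Nat.lt_succ_iff.mp hi
    · exact (hne j hj).le
  · refine hg'.not_ge fun j => ?_
    by_cases hj : j = i
    · subst hj; rw [hH, Function.update_self]; exact hi.ge
    · rw [hH, Function.update_of_ne hj]; exact (hne j hj).ge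

/-- A function on the positions of a walk that increases strictly along direct letters and
decreases strictly along inverse letters. -/
def rank (d : Fin n → Bool) (i : Fin (n + 1)) : ℤ :=
  ∑ k : Fin n, if k.castSucc < i then (if d k = true then 1 else -1) else 0

theorem rank_succ (k : Fin n) :
    rank d k.succ = rank d k.castSucc + if d k = true then 1 else -1 := by
  have h (j : Fin n) : (if j.castSucc < k.succ then (if d j = true then 1 else -1) else 0 : ℤ) =
      (if j.castSucc < k.castSucc then (if d j = true then 1 else -1) else 0) +
        if j = k then (if d j = true then 1 else -1) else 0 := by
    simp only [Fin.castSucc_lt_succ_iff, Fin.castSucc_lt_castSucc_iff, le_iff_lt_or_eq]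
    by_cases hj : j = k
    · simp [hj]
    · simp [hj]
  rw [rank, Finset.sum_congr rfl fun j _ => h j, Finset.sum_add_distrib,
    Finset.sum_ite_eq' Finset.univ k, if_pos (Finset.mem_univ k), rank]

/-- Among the positions where `h` is below `h'`, one of maximal rank is raised. The neighbours that
must stay above it have larger rank, so there `h` already equals `h'` and leaves room. -/
theorem exists_raise_le {h h' : HeightFunction d} (hlt : h < h') :
    ∃ i g, Raise i h g ∧ g ≤ h' := by
  have hle : ∀ j, h.val j ≤ h'.val j := fun j => hlt.le j
  have hne : (Finset.univ.filter fun j => h.val j < h'.val j).Nonempty := by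
    by_contra! H
    refine hlt.not_ge fun j => ?_
    by_contra! hj
    have : j ∈ (Finset.univ.filter fun j => h.val j < h'.val j) := by simpa using hj
    simp [H] at this
  obtain ⟨i, hi, hmax⟩ := Finset.exists_max_image _ (rank d) hne
  simp only [Finset.mem_filter, Finset.mem_univ, true_and] at hi hmax
  have hmax' : ∀ j, rank d i < rank d j → h.val j = h'.val j := fun j hj =>
    le_antisymm (hle j) (not_lt.mp fun hlt => (hmax j hlt).not_gt hj)
  refine ⟨i, ⟨Function.update h.val i (h.val i + 1), fun j => ?_, fun k => ?_⟩, rfl, fun j => ?_⟩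
  · by_cases hj : j = i
    · subst hj
      rw [Function.update_self]
      have := h'.2.1 j
      omega
    · rw [Function.update_of_ne hj]; exact h.2.1 j
  · have h1 := h.2.2 k
    have h2 := h'.2.2 k
    have hr := rank_succ (d := d) k
    have hk : k.castSucc ≠ k.succ := k.castSucc_lt_succ.ne
    split_ifs at h1 h2 hr ⊢ with hd
    · by_cases hi1 : k.castSucc = i
      · subst hi1
        rw [Function.update_self, Function.update_of_ne hk.symm]
        -- Here `h i + 1 ≤ h' i ≤ h' k.succ = h k.succ`.
        have := hmax' k.succ (by omega)
        omega
      · rw [Function.update_of_ne hi1]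
        by_cases hi2 : k.succ = i
        · subst hi2; rw [Function.update_self]; omega
        · rwa [Function.update_of_ne hi2]
    · by_cases hi1 : k.succ = i
      · subst hi1
        rw [Function.update_self, Function.update_of_ne hk]
        have := hmax' k.castSucc (by omega)
        omega
      · rw [Function.update_of_ne hi1]
        by_cases hi2 : k.castSucc = i
        · subst hi2; rw [Function.update_self]; omega
        · rwa [Function.update_of_ne hi2]
  · by_cases hj : j = i
    · subst hj
      change Function.update h.val j (h.val j + 1) j ≤ h'.val j
      rw [Function.update_self]; exact hi
    · change Function.update h.val i (h.val i + 1) j ≤ h'.val j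
      rw [Function.update_of_ne hj]; exact hle j

theorem covBy_iff {h h' : HeightFunction d} : h ⋖ h' ↔ ∃ i, Raise i h h' := by
  refine ⟨fun H => ?_, fun ⟨i, hi⟩ => hi.covBy⟩
  obtain ⟨i, g, hg, hgh⟩ := exists_raise_le H.lt
  rcases hgh.lt_or_eq with hlt | rfl
  · exact absurd hlt (H.2 hg.lt)
  · exact ⟨i, hg⟩

theorem le_iff_reflTransGen {h h' : HeightFunction d} :
    h ≤ h' ↔ Relation.ReflTransGen (fun g g' => ∃ i, Raise i g g') h h' := by
  constructor
  · intro hle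
    -- The total gap to `h'` drops with each raise; truncated subtraction is harmless as all
    -- functions involved stay below `h'`.
    induction hm : ∑ i, (h'.val i - h.val i) using Nat.strong_induction_on generalizing h with
    | _ m ih =>
      rcases hle.lt_or_eq with hlt | rfl
      · obtain ⟨i, g, hg, hgh⟩ := exists_raise_le hlt
        refine Relation.ReflTransGen.head ⟨i, hg⟩ (ih _ ?_ hgh rfl)
        have hg' : g.val = _ := hg
        have h1 : ∀ j, g.val j ≤ h'.val j := fun j => hgh j
        have h2 : ∀ j, h.val j ≤ g.val j := fun j => hg.lt.le j
        rw [← hm]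
        refine Finset.sum_lt_sum (fun j _ => Nat.sub_le_sub_left (h2 j) _)
          ⟨i, Finset.mem_univ i, ?_⟩
        have h3 := h1 i
        rw [hg', Function.update_self] at h3 ⊢
        omega
      · exact Relation.ReflTransGen.refl
  · intro H
    induction H with
    | refl => exact le_refl _
    | tail _ h ih => exact ih.trans h.choose_spec.lt.le

theorem isHeight_sup (h h' : HeightFunction d) : IsHeight d (h.val ⊔ h'.val) := by
  refine ⟨fun i => sup_le (h.2.1 i) (h'.2.1 i), fun k => ?_⟩
  have h1 := h.2.2 k
  have h2 := h'.2.2 k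
  split_ifs at h1 h2 ⊢
  · exact sup_le_sup h1 h2
  · exact sup_le_sup h1 h2

theorem isHeight_inf (h h' : HeightFunction d) : IsHeight d (h.val ⊓ h'.val) := by
  refine ⟨fun i => (inf_le_left).trans (h.2.1 i), fun k => ?_⟩
  have h1 := h.2.2 k
  have h2 := h'.2.2 k
  split_ifs at h1 h2 ⊢
  · exact inf_le_inf h1 h2
  · exact inf_le_inf h1 h2

theorem exists_isLUB (h h' : HeightFunction d) : ∃ g, IsLUB {h, h'} g :=
  ⟨⟨_, isHeight_sup h h'⟩, by
    constructor
    · rintro g (rfl | rfl)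
      exacts [le_sup_left (a := g.val), le_sup_right (b := g.val)]
    · intro g hg
      exact sup_le (α := Fin (n + 1) → ℕ) (hg (.inl rfl)) (hg (.inr rfl))⟩

theorem exists_isGLB (h h' : HeightFunction d) : ∃ g, IsGLB {h, h'} g :=
  ⟨⟨_, isHeight_inf h h'⟩, by
    constructor
    · rintro g (rfl | rfl)
      exacts [inf_le_left (a := g.val), inf_le_right (b := g.val)]
    · intro g hg
      exact le_inf (α := Fin (n + 1) → ℕ) (hg (.inl rfl)) (hg (.inr rfl))⟩

end HeightFunction

/-! ### Double dimer covers and height functions -/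

namespace SnakeGraph

/-- Along the word, the direction of gluing changes exactly when the type of the letter does not,
and the parity of `k` always changes. The equivalence therefore propagates from the first letter. It
is all that the covers need to know about `w`. -/
theorem IsSnakeGraphOf.direct_iff {Q : Type*} [Quiver Q] {w : QWalk Q} {G : SnakeGraph w.length}
    (hG : IsSnakeGraphOf w G) (k : Fin w.length) :
    w.direct k = true ↔ (G.step k = .east ↔ Even k.val) := by
  obtain ⟨k, hk⟩ := k
  induction k with
  | zero => simpa using (hG.1 ⟨0, hk⟩ rfl).symm
  | succ k ih =>
    have h1 := ih (by omega)
    have h2 := hG.2 ⟨k, by omega⟩ ⟨k + 1, hk⟩ rfl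
    simp only [Nat.even_add_one] at h1 ⊢
    cases hs : G.step ⟨k, by omega⟩ <;> cases hs' : G.step ⟨k + 1, hk⟩ <;>
      cases hw : w.direct ⟨k, by omega⟩ <;> cases hw' : w.direct ⟨k + 1, hk⟩ <;>
      simp_all

variable {n : ℕ} (G : SnakeGraph n) {d : Fin n → Bool}

/-- The weights of the tiles that correspond to the values of a height function. -/
def tileWeight (h : Fin (n + 1) → ℕ) (i : Fin (n + 1)) : ℤ :=
  if Even i.val then 2 - h i else h i

/-- The alternation in `tileWeight` turns the sum of two neighbouring weights into a difference of
heights. Its sign depends on the parity of `k` and on the direction of gluing, hence only on the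
type of the letter. -/
theorem edgeSum_tileWeight_glue (hd : ∀ k, d k = true ↔ (G.step k = .east ↔ Even k.val))
    (h : Fin (n + 1) → ℕ) (k : Fin n) : G.edgeSum (tileWeight h) (G.glue k) =
      if d k = true then (h k.succ : ℤ) - h k.castSucc else (h k.castSucc : ℤ) - h k.succ := by
  rw [edgeSum_glue, tileWeight, tileWeight, Fin.val_succ, Fin.val_castSucc]
  simp only [hd k, Nat.even_add_one]
  by_cases h1 : G.step k = .east <;> by_cases h2 : Even k.val <;> simp [h1, h2] <;> ring

/-- On boundary edges this is the bound `h i ≤ 2`, on shared edges monotonicity along the letter. It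
makes the truncation in `heightMultiset` harmless. -/
theorem edgeSum_tileWeight_nonneg (hd : ∀ k, d k = true ↔ (G.step k = .east ↔ Even k.val))
    (h : HeightFunction d) {e : Sym2 (ℕ × ℕ)} (he : e ∈ G.edges) :
    0 ≤ G.edgeSum (tileWeight h.val) e := by
  obtain ⟨i, hi⟩ := he
  rcases unique_or_eq_glue hi with hu | ⟨k, rfl⟩
  · have h2 := h.2.1 i
    rw [edgeSum_of_unique _ hi hu, sideWeight, tileWeight]
    split_ifs <;> omega
  · have h2 := h.2.2 k
    rw [edgeSum_tileWeight_glue G hd]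
    split_ifs at h2 ⊢ <;> omega

theorem finite_edges : G.edges.Finite := by
  have : G.edges = ⋃ i, G.tileEdges i := by ext e; simp [edges]
  rw [this]
  exact Set.finite_iUnion fun i => by simp [tileEdges]

/-- The multiset of edges that corresponds to a height function. -/
def heightMultiset (h : Fin (n + 1) → ℕ) : Multiset (Sym2 (ℕ × ℕ)) :=
  ∑ e ∈ G.finite_edges.toFinset, Multiset.replicate (G.edgeSum (tileWeight h) e).toNat e

theorem count_heightMultiset (hd : ∀ k, d k = true ↔ (G.step k = .east ↔ Even k.val))
    (h : HeightFunction d) {e : Sym2 (ℕ × ℕ)} (he : e ∈ G.edges) :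
    ((G.heightMultiset h.val).count e : ℤ) = G.edgeSum (tileWeight h.val) e := by
  rw [heightMultiset, Multiset.count_sum']
  simp only [Multiset.count_replicate]
  rw [Finset.sum_ite_eq', if_pos (G.finite_edges.mem_toFinset.mpr he),
    Int.toNat_of_nonneg (edgeSum_tileWeight_nonneg G hd h he)]

theorem mem_edges_of_mem_heightMultiset {h : Fin (n + 1) → ℕ} {e : Sym2 (ℕ × ℕ)}
    (he : e ∈ G.heightMultiset h) : e ∈ G.edges := by
  rw [heightMultiset, Multiset.mem_sum] at he
  obtain ⟨e', he', h⟩ := he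
  rw [Multiset.eq_of_mem_replicate h]
  exact G.finite_edges.mem_toFinset.mp he'

/-- The double dimer cover that corresponds to a height function. -/
def heightCover (hd : ∀ k, d k = true ↔ (G.step k = .east ↔ Even k.val))
    (h : HeightFunction d) : G.DoubleDimerCover :=
  ⟨G.heightMultiset h.val, fun _ => G.mem_edges_of_mem_heightMultiset,
    ((hasWeights_edgeSum (tileWeight h.val)).congr fun _ he =>
      G.count_heightMultiset hd h he).card_filter fun _ => G.mem_edges_of_mem_heightMultiset⟩

variable {G}

theorem count_heightCover (hd : ∀ k, d k = true ↔ (G.step k = .east ↔ Even k.val))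
    (h : HeightFunction d) {e : Sym2 (ℕ × ℕ)} (he : e ∈ G.edges) :
    ((G.heightCover hd h).val.count e : ℤ) = G.edgeSum (tileWeight h.val) e :=
  G.count_heightMultiset hd h he

theorem DoubleDimerCover.ext_count {D D' : G.DoubleDimerCover}
    (h : ∀ e ∈ G.edges, (D.val.count e : ℤ) = D'.val.count e) : D = D' := by
  refine Subtype.ext (Multiset.ext.mpr fun e => ?_)
  by_cases he : e ∈ G.edges
  · exact_mod_cast h e he
  · rw [Multiset.count_eq_zero.mpr fun h' => he (D.2.1 e h'),
      Multiset.count_eq_zero.mpr fun h' => he (D'.2.1 e h')]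

theorem tileWeight_injective : Function.Injective (tileWeight (n := n)) := by
  intro h h' H
  funext i
  have hi := congrFun H i
  rw [tileWeight, tileWeight] at hi
  split_ifs at hi <;> omega

/-- Every tile has a South or West edge that is not shared with its predecessor, and its
multiplicity reveals the weight. -/
theorem HasWeights.unique {c : Sym2 (ℕ × ℕ) → ℤ} {a a' : Fin (n + 1) → ℤ}
    (h : G.HasWeights c a) (h' : G.HasWeights c a') : a = a' := by
  funext i
  induction i using Fin.cases with
  | zero => rw [← h.west_zero, h'.west_zero]
  | succ k =>
    by_cases hk : G.step k = .east
    · have h1 := h.south_succ k hk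
      have h2 := h'.south_succ k hk
      omega
    · rw [← h.west_succ k hk, h'.west_succ k hk]

theorem hasWeights_heightCover (hd : ∀ k, d k = true ↔ (G.step k = .east ↔ Even k.val))
    (h : HeightFunction d) :
    G.HasWeights (fun e => (G.heightCover hd h).val.count e) (tileWeight h.val) :=
  (hasWeights_edgeSum _).congr fun _ he => count_heightCover hd h he

theorem heightCover_injective (hd : ∀ k, d k = true ↔ (G.step k = .east ↔ Even k.val)) :
    Function.Injective (G.heightCover hd) := fun h h' H =>
  Subtype.ext (tileWeight_injective
    ((hasWeights_heightCover hd h).unique (H ▸ hasWeights_heightCover hd h')))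

/-- The weights of a cover are its numbers `inNW`, and inverting `tileWeight` gives the candidate
height. It is monotone along letters because multiplicities of shared edges are nonnegative. -/
theorem heightCover_surjective (hd : ∀ k, d k = true ↔ (G.step k = .east ↔ Even k.val)) :
    Function.Surjective (G.heightCover hd) := by
  intro D
  have hD := hasWeights_inNW D.2.1 D.2.2
  -- Needed for the natural subtraction in `h` to be a true one.
  have hle (i) : G.inNW D.val i ≤ 2 := by
    have := hD.outNW_eq i
    omega
  set h : Fin (n + 1) → ℕ := fun i => if Even i.val then 2 - G.inNW D.val i else G.inNW D.val i
    with hh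
  have ht : tileWeight h = fun i => (G.inNW D.val i : ℤ) := by
    funext i
    have := hle i
    rw [tileWeight, hh]
    split_ifs with hi
    · simp only [hi, if_true]; omega
    · simp only [hi, if_false]
  rw [← ht] at hD
  have hcount {e} (he : e ∈ G.edges) : (D.val.count e : ℤ) = G.edgeSum (tileWeight h) e :=
    hD.eq_of_mem (hasWeights_edgeSum _) he
  have hheight : IsHeight d h := by
    refine ⟨fun i => ?_, fun k => ?_⟩
    · have := hle i
      rw [hh]; dsimp only; split_ifs <;> omega
    · have h1 := hcount (glue_mem_edges k)
      rw [edgeSum_tileWeight_glue G hd] at h1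
      split_ifs at h1 ⊢ <;> omega
  refine ⟨⟨h, hheight⟩, DoubleDimerCover.ext_count fun e he => ?_⟩
  rw [count_heightCover hd _ he, hcount he]

/-- The change of the multiplicity of an edge under an upward twist. -/
theorem upTwist_iff_count {i : Fin (n + 1)} {D D' : G.DoubleDimerCover} :
    G.UpTwist i D D' ↔ ∀ e, (D'.val.count e : ℤ) = D.val.count e +
      (if Even i.val then -1 else 1) *
        ((if e = G.west i then 1 else 0) + (if e = G.east i then 1 else 0) -
         (if e = G.south i then 1 else 0) - (if e = G.north i then 1 else 0)) := by
  have hp (e a b : Sym2 (ℕ × ℕ)) : Multiset.count e {a, b} =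
      (if e = a then 1 else 0) + if e = b then 1 else 0 := by
    rw [Multiset.insert_eq_cons, Multiset.count_cons, Multiset.count_singleton, add_comm]
  have h1 : G.west i ≠ G.south i := (hEdge_ne_vEdge _ _ _ _).symm
  have h2 : G.west i ≠ G.north i := (hEdge_ne_vEdge _ _ _ _).symm
  have h3 : G.east i ≠ G.south i := (hEdge_ne_vEdge _ _ _ _).symm
  have h4 : G.east i ≠ G.north i := (hEdge_ne_vEdge _ _ _ _).symm
  have h5 : G.west i ≠ G.east i := by rw [west_eq, east_eq, Ne, vEdge_inj]; omega
  have h6 : G.south i ≠ G.north i := by rw [south_eq, north_eq, Ne, hEdge_inj]; omega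
  have hpair {M : Multiset (Sym2 (ℕ × ℕ))} {a b : Sym2 (ℕ × ℕ)} (hab : a ≠ b)
      (ha : 1 ≤ M.count a) (hb : 1 ≤ M.count b) : ({a, b} : Multiset _) ≤ M := by
    rw [Multiset.le_iff_count]
    intro e
    rw [hp]
    split_ifs with ha' hb' hb'
    · exact absurd (ha'.symm.trans hb') hab
    · exact ha' ▸ ha
    · exact hb' ▸ hb
    · exact Nat.zero_le _
  constructor
  · rintro ⟨R, hR⟩ e
    split_ifs at hR with hi
    · rw [hR.1, hR.2, if_pos hi, Multiset.count_add, Multiset.count_add, hp, hp]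
      push_cast; ring
    · rw [hR.1, hR.2, if_neg hi, Multiset.count_add, Multiset.count_add, hp, hp]
      push_cast; ring
  · intro H
    by_cases hi : Even i.val
    · simp only [if_pos hi] at H
      -- The formula lowers these two multiplicities by one and the result is still nonnegative, so
      -- `D` contains both edges and the rest can serve as `R`.
      have hle : ({G.west i, G.east i} : Multiset _) ≤ D.val := by
        have hw := H (G.west i)
        have he := H (G.east i)
        rw [if_pos rfl, if_neg h5, if_neg h1, if_neg h2] at hw
        rw [if_pos rfl, if_neg h5.symm, if_neg h3, if_neg h4] at he
        exact hpair h5 (by omega) (by omega)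
      refine ⟨D.val - {G.west i, G.east i}, ?_⟩
      rw [if_pos hi]
      refine ⟨(Multiset.sub_add_cancel hle).symm, Multiset.ext.mpr fun e => ?_⟩
      have h1 := H e
      have h2 := Multiset.le_iff_count.mp hle e
      rw [Multiset.count_add, Multiset.count_sub]
      rw [hp] at h2 ⊢
      rw [hp]
      zify [h2]
      rw [h1]; ring
    · simp only [if_neg hi] at H
      have hle : ({G.south i, G.north i} : Multiset _) ≤ D.val := by
        have hs := H (G.south i)
        have hn := H (G.north i)
        rw [if_pos rfl, if_neg h6, if_neg h1.symm, if_neg h3.symm] at hs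
        rw [if_pos rfl, if_neg h6.symm, if_neg h2.symm, if_neg h4.symm] at hn
        exact hpair h6 (by omega) (by omega)
      refine ⟨D.val - {G.south i, G.north i}, ?_⟩
      rw [if_neg hi]
      refine ⟨(Multiset.sub_add_cancel hle).symm, Multiset.ext.mpr fun e => ?_⟩
      have h1 := H e
      have h2 := Multiset.le_iff_count.mp hle e
      rw [Multiset.count_add, Multiset.count_sub]
      rw [hp] at h2 ⊢
      rw [hp]
      zify [h2]
      rw [h1]; ring

theorem tileWeight_update (h : Fin (n + 1) → ℕ) (i : Fin (n + 1)) :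
    tileWeight (Function.update h i (h i + 1)) =
      Function.update (tileWeight h) i (tileWeight h i + if Even i.val then -1 else 1) := by
  funext j
  by_cases hj : j = i
  · subst hj
    rw [tileWeight, Function.update_self, Function.update_self, tileWeight]
    split_ifs <;> push_cast <;> ring
  · rw [tileWeight, Function.update_of_ne hj, Function.update_of_ne hj, tileWeight]

/-- A twist and a raise change edge multiplicities by the same amounts (`key`), and weights
determine heights. -/
theorem upTwist_heightCover_iff (hd : ∀ k, d k = true ↔ (G.step k = .east ↔ Even k.val))
    {i : Fin (n + 1)} {h h' : HeightFunction d} :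
    G.UpTwist i (G.heightCover hd h) (G.heightCover hd h') ↔ HeightFunction.Raise i h h' := by
  have key (e) : G.edgeSum (tileWeight (Function.update h.val i (h.val i + 1))) e =
      G.edgeSum (tileWeight h.val) e + (if Even i.val then -1 else 1) *
        ((if e = G.west i then 1 else 0) + (if e = G.east i then 1 else 0) -
         (if e = G.south i then 1 else 0) - (if e = G.north i then 1 else 0)) := by
    rw [tileWeight_update, edgeSum_update, add_sub_cancel_left, mul_sub, mul_sub, mul_add]
    simp only [mul_ite, mul_one, mul_zero]
  rw [upTwist_iff_count]
  constructor
  · intro H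
    refine tileWeight_injective ((hasWeights_heightCover hd h').unique
      ((hasWeights_edgeSum _).congr fun e he => ?_))
    rw [H, key, count_heightCover hd h he]
  · intro H e
    by_cases he : e ∈ G.edges
    · rw [count_heightCover hd h he, count_heightCover hd h' he, ← key]
      rw [show h'.val = _ from H]
    -- Off the graph `edgeSum` is no multiplicity; there both covers have count zero and the twist
    -- changes nothing.
    · have h1 : e ≠ G.west i := fun h => he ⟨i, .inl h⟩
      have h2 : e ≠ G.east i := fun h => he ⟨i, .inr (.inl h)⟩
      have h3 : e ≠ G.south i := fun h => he ⟨i, .inr (.inr (.inl h))⟩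
      have h4 : e ≠ G.north i := fun h => he ⟨i, .inr (.inr (.inr h))⟩
      rw [Multiset.count_eq_zero.mpr fun h' => he ((G.heightCover hd _).2.1 e h'),
        Multiset.count_eq_zero.mpr fun h' => he ((G.heightCover hd _).2.1 e h')]
      simp [h1, h2, h3, h4]

/-- Double dimer covers correspond to height functions. -/
def heightCoverIso (hd : ∀ k, d k = true ↔ (G.step k = .east ↔ Even k.val)) :
    HeightFunction d ≃o G.DoubleDimerCover where
  toEquiv := Equiv.ofBijective (G.heightCover hd)
    ⟨heightCover_injective hd, heightCover_surjective hd⟩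
  map_rel_iff' := by
    intro h h'
    rw [HeightFunction.le_iff_reflTransGen]
    change Relation.ReflTransGen (fun D D' => ∃ i, G.UpTwist i D D')
      (G.heightCover hd h) (G.heightCover hd h') ↔ _
    constructor
    · intro H
      generalize hA : G.heightCover hd h = A at H
      generalize hB : G.heightCover hd h' = B at H
      induction H generalizing h' with
      | refl => rw [heightCover_injective hd (hA.trans hB.symm)]
      | @tail B C _ hs ih =>
        -- Intermediate covers also come from height functions, so a chain of twists lifts to a
        -- chain of raises.
        obtain ⟨g, rfl⟩ := heightCover_surjective hd B
        obtain ⟨i, hi⟩ := hs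
        rw [← hB, upTwist_heightCover_iff] at hi
        exact (ih rfl).tail ⟨i, hi⟩
    · intro H
      induction H with
      | refl => exact Relation.ReflTransGen.refl
      | tail _ hs ih =>
        exact ih.tail ⟨_, (upTwist_heightCover_iff hd).mpr hs.choose_spec⟩

/-! ### Boundary edges and the extreme covers -/

theorem edgeSum_tileWeight_of_isBoundary {e : Sym2 (ℕ × ℕ)} {i : Fin (n + 1)}
    (hi : e ∈ G.tileEdges i) (he : G.IsBoundary e) (h : Fin (n + 1) → ℕ) :
    G.edgeSum (tileWeight h) e = G.sideWeight (tileWeight h) i e :=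
  edgeSum_of_unique _ hi fun _ hj => he.unique hj hi

theorem isBoundary_west_zero : G.IsBoundary (G.west 0) := by
  by_contra h
  obtain ⟨k, hk⟩ := exists_eq_glue_of_not_isBoundary ⟨0, .inl rfl⟩ h
  exact west_ne_glue (fun k h => absurd h (Fin.succ_ne_zero k).symm) k hk

/-- A cover that consists of boundary edges corresponds to a constant height function. -/
theorem forall_isBoundary_heightCover_iff
    (hd : ∀ k, d k = true ↔ (G.step k = .east ↔ Even k.val)) (h : HeightFunction d) :
    (∀ e ∈ (G.heightCover hd h).val, G.IsBoundary e) ↔ ∀ i, h.val i = h.val 0 := by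
  have hg (k) : ((G.heightCover hd h).val.count (G.glue k) : ℤ) = _ :=
    (count_heightCover hd h (glue_mem_edges k)).trans (edgeSum_tileWeight_glue G hd _ k)
  constructor
  · intro H i
    induction i using Fin.induction with
    | zero => rfl
    | succ k ih =>
      have h1 := hg k
      rw [Multiset.count_eq_zero.mpr fun h' => not_isBoundary_glue k (H _ h')] at h1
      split_ifs at h1 <;> omega
  · intro H e he
    by_contra hb
    obtain ⟨k, rfl⟩ := exists_eq_glue_of_not_isBoundary ((G.heightCover hd h).2.1 e he) hb
    have h1 := hg k
    rw [H k.succ, H k.castSucc, sub_self, ite_self] at h1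
    exact Multiset.count_ne_zero.mpr he (by exact_mod_cast h1)

/-- Using boundary edges only forces a constant height, and the West edge of the first tile has
multiplicity `2 - h 0`. -/
theorem isMinimal_heightCover_iff (hd : ∀ k, d k = true ↔ (G.step k = .east ↔ Even k.val))
    (h : HeightFunction d) : G.IsMinimal (G.heightCover hd h) ↔ ∀ i, h.val i = 0 := by
  have hw := (hasWeights_heightCover hd h).west_zero
  rw [IsMinimal, forall_isBoundary_heightCover_iff]
  simp only [tileWeight, Fin.val_zero, Even.zero, if_true] at hw
  constructor
  · rintro ⟨h1, h2⟩ i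
    rw [h1 i]; omega
  · intro H
    have := H 0
    exact ⟨fun i => by rw [H, H], by omega⟩

theorem isMaximal_heightCover_iff (hd : ∀ k, d k = true ↔ (G.step k = .east ↔ Even k.val))
    (h : HeightFunction d) : G.IsMaximal (G.heightCover hd h) ↔ ∀ i, h.val i = 2 := by
  have h0 : IsHeight d 0 := ⟨fun i => by simp, fun k => by simp⟩
  -- Existence and uniqueness of the minimal cover; without existence the complement condition would
  -- be vacuous.
  have hm : ∀ D₀, G.IsMinimal D₀ ↔ D₀ = G.heightCover hd ⟨0, h0⟩ := by
    intro D₀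
    obtain ⟨g, rfl⟩ := heightCover_surjective hd D₀
    rw [isMinimal_heightCover_iff, (heightCover_injective hd).eq_iff, Subtype.ext_iff]
    exact funext_iff.symm
  rw [IsMaximal, forall_isBoundary_heightCover_iff]
  simp only [hm, forall_eq]
  constructor
  · rintro ⟨h1, h2⟩ i
    have hw := (hasWeights_heightCover hd h).west_zero
    have hw' := (hasWeights_heightCover hd ⟨0, h0⟩).west_zero
    have h3 := h2 _ isBoundary_west_zero
    simp only [tileWeight, Fin.val_zero, Even.zero, if_true, Pi.zero_apply] at hw hw'
    rw [h1 i]; omega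
  · intro H
    refine ⟨fun i => by rw [H, H], fun e he => ?_⟩
    obtain ⟨i, hi, -⟩ := id he
    have h1 := count_heightCover hd h ⟨i, hi⟩
    have h2 := count_heightCover hd ⟨0, h0⟩ ⟨i, hi⟩
    rw [edgeSum_tileWeight_of_isBoundary hi he, sideWeight, tileWeight] at h1 h2
    have h3 := H i
    simp only [Pi.zero_apply] at h2
    split_ifs at h1 h2 <;> omega

/-- The symmetric difference with the minimal cover determines the height function. -/
theorem count_multisetSymmDiff_heightCover
    (hd : ∀ k, d k = true ↔ (G.step k = .east ↔ Even k.val)) (h : HeightFunction d)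
    {D₀ : G.DoubleDimerCover} (hD₀ : G.IsMinimal D₀) {e : Sym2 (ℕ × ℕ)} {i : Fin (n + 1)}
    (hi : e ∈ G.tileEdges i) (he : G.IsBoundary e) :
    (multisetSymmDiff (G.heightCover hd h).val D₀.val).count e = h.val i := by
  obtain ⟨g, rfl⟩ := heightCover_surjective hd D₀
  have hg := (isMinimal_heightCover_iff hd g).mp hD₀ i
  have h1 := count_heightCover hd h ⟨i, hi⟩
  have h2 := count_heightCover hd g ⟨i, hi⟩
  have h3 := h.2.1 i
  rw [edgeSum_tileWeight_of_isBoundary hi he, sideWeight, tileWeight] at h1 h2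
  -- The multiplicity is `max - min`. The minimal cover contributes 0 or 2, and `h i` or `2 - h i`
  -- respectively comes from the other cover.
  rw [multisetSymmDiff, Multiset.count_sub, Multiset.count_union, Multiset.count_inter]
  split_ifs at h1 h2 <;> omega

end SnakeGraph

/-! ### Canonical submodules -/

namespace QWalk

variable {Q : Type*} [Quiver Q] {w : QWalk Q}

/-- In a reduced walk, an arrow leads from a given position to at most one position. -/
theorem Reduced.step_unique (hw : w.Reduced) {α : Quiver.Total Q} {i j j' : Fin (w.length + 1)}
    (h : w.Step α i j) (h' : w.Step α i j') : j = j' := by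
  obtain ⟨k, hk, ⟨hd, rfl, rfl⟩ | ⟨hd, rfl, rfl⟩⟩ := h <;>
    obtain ⟨l, hl, ⟨hd', hi, rfl⟩ | ⟨hd', hi, rfl⟩⟩ := h'
  · rw [Fin.castSucc_injective _ hi]
  · have := hw l k (congrArg Fin.val hi) (hl.trans hk.symm)
    simp [hd, hd'] at this
  · have := hw k l (congrArg Fin.val hi.symm) (hk.trans hl.symm)
    simp [hd, hd'] at this
  · rw [Fin.succ_injective _ hi]

/-- Reducedness leaves a single term in the sum defining the action, so arrows send basis vectors to
basis vectors and a submodule containing `z_i` contains the endpoint of each step. -/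
theorem arrowAct_single (K : Type*) [Field K] (hw : w.Reduced) {α : Quiver.Total Q}
    {i j : Fin (w.length + 1)} (h : w.Step α i j) :
    w.arrowAct K α (Finsupp.single i 1) = Finsupp.single j 1 := by
  classical
  simp only [arrowAct, Finsupp.linearCombination_single, one_smul]
  rw [Finset.sum_eq_single j, if_pos h]
  · exact fun l _ hl => if_neg fun h' => hl (hw.step_unique h' h)
  · simp

theorem rep_of {K : Type*} [Field K] [Fintype Q] (p : QPath Q) :
    w.rep K (PathAlgebra.of p) = w.pathAct K p.path :=
  PathAlgebra.lin_of _ _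

theorem rep_arrow_single {K : Type*} [Field K] [Fintype Q] (hw : w.Reduced) {α : Quiver.Total Q}
    {i j : Fin (w.length + 1)} (h : w.Step α i j) :
    w.rep K (PathAlgebra.of ⟨α.left, α.right, Quiver.Path.nil.cons α.hom⟩)
      (Finsupp.single i 1) = Finsupp.single j 1 := by
  have h1 : w.rep K (PathAlgebra.of ⟨α.left, α.right, Quiver.Path.nil.cons α.hom⟩) =
      w.arrowAct K α := by
    rw [rep_of, pathAct, pathAct]
    exact w.arrowAct_mul_vertexAct K α
  rw [h1, arrowAct_single K hw h]

/-- A set of standard basis vectors of the induced module is closed if it is stable under the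
arrows and under `ε`. -/
def IsClosedSet (w : QWalk Q) (S : Set (Fin (w.length + 1) × Bool)) : Prop :=
  (∀ i, (i, false) ∈ S → (i, true) ∈ S) ∧
    ∀ α i j c, w.Step α i j → (i, c) ∈ S → (j, c) ∈ S

theorem IsClosedSet.reads {S : Set (Fin (w.length + 1) × Bool)} (hS : w.IsClosedSet S) {a b : Q}
    (p : Quiver.Path a b) {i j : Fin (w.length + 1)} {c : Bool} (h : w.Reads p i j)
    (hi : (i, c) ∈ S) : (j, c) ∈ S := by
  induction p generalizing j with
  | nil =>
    rw [Reads] at h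
    exact h.1 ▸ hi
  | cons p α ih =>
    rw [Reads] at h
    obtain ⟨k, hk, hs⟩ := h
    exact hS.2 _ _ _ _ hs (ih hk)

/-- The set of standard basis vectors determined by a height function. -/
def heightSet (w : QWalk Q) (h : Fin (w.length + 1) → ℕ) : Set (Fin (w.length + 1) × Bool) :=
  {b | (if b.2 then 1 else 2) ≤ h b.1}

theorem true_mem_heightSet {h : Fin (w.length + 1) → ℕ} {i : Fin (w.length + 1)} :
    (i, true) ∈ w.heightSet h ↔ 1 ≤ h i := by simp [heightSet]

theorem false_mem_heightSet {h : Fin (w.length + 1) → ℕ} {i : Fin (w.length + 1)} :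
    (i, false) ∈ w.heightSet h ↔ 2 ≤ h i := by simp [heightSet]

theorem isClosedSet_heightSet {h : Fin (w.length + 1) → ℕ} (hh : IsHeight w.direct h) :
    w.IsClosedSet (w.heightSet h) := by
  refine ⟨fun i => ?_, fun α i j c hs hi => ?_⟩
  · rw [true_mem_heightSet, false_mem_heightSet]; omega
  · refine le_trans (b := h i) hi ?_
    obtain ⟨k, -, ⟨hd, rfl, rfl⟩ | ⟨hd, rfl, rfl⟩⟩ := hs <;> simpa [hd] using hh.2 k

/-- Closure under `ε` excludes having `z_i ⊗ 1` without `z_i ⊗ ε`, so three cases remain at each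
position. -/
theorem IsClosedSet.exists_eq_heightSet {S : Set (Fin (w.length + 1) × Bool)}
    (hS : w.IsClosedSet S) : ∃ h, IsHeight w.direct h ∧ w.heightSet h = S := by
  classical
  set h : Fin (w.length + 1) → ℕ := fun i =>
    if (i, false) ∈ S then 2 else if (i, true) ∈ S then 1 else 0 with hh
  have h2 : ∀ i, h i ≤ 2 := fun i => by rw [hh]; dsimp only; split_ifs <;> omega
  have hstep : ∀ α i j, w.Step α i j → h i ≤ h j := by
    intro α i j hs
    have h1 := hS.2 α i j false hs
    have h2 := hS.2 α i j true hs
    rw [hh]; dsimp only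
    split_ifs <;> first | omega | tauto
  refine ⟨h, ⟨h2, fun k => ?_⟩, ?_⟩
  · split_ifs with hd
    · exact hstep _ _ _ ⟨k, rfl, .inl ⟨hd, rfl, rfl⟩⟩
    · exact hstep _ _ _ ⟨k, rfl, .inr ⟨by simpa using hd, rfl, rfl⟩⟩
  · ext ⟨i, c⟩
    have h1 := hS.1 i
    cases c
    · rw [false_mem_heightSet, hh]; dsimp only
      split_ifs <;> simp_all
    · rw [true_mem_heightSet, hh]; dsimp only
      split_ifs <;> simp_all

/-- Membership only tests the thresholds 1 and 2, so the bound on `h` is what allows heights to be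
recovered. -/
theorem heightSet_subset_iff {h h' : Fin (w.length + 1) → ℕ} (hh : ∀ i, h i ≤ 2) :
    w.heightSet h ⊆ w.heightSet h' ↔ h ≤ h' := by
  constructor
  · intro H i
    have h1 := @H (i, true)
    have h2 := @H (i, false)
    rw [true_mem_heightSet, true_mem_heightSet] at h1
    rw [false_mem_heightSet, false_mem_heightSet] at h2
    have := hh i
    change h i ≤ h' i
    omega
  · exact fun H b hb => le_trans (b := h b.1) hb (H b.1)

theorem heightSet_eq_insert_iff {h h' : Fin (w.length + 1) → ℕ} (hh : ∀ i, h i ≤ 2)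
    (hh' : ∀ i, h' i ≤ 2) {i : Fin (w.length + 1)} :
    (∃ c, (i, c) ∉ w.heightSet h ∧ w.heightSet h' = insert (i, c) (w.heightSet h)) ↔
      h' = Function.update h i (h i + 1) := by
  constructor
  · rintro ⟨c, hc, H⟩
    funext j
    have h1 : (j, true) ∈ w.heightSet h' ↔ (j, true) = (i, c) ∨ (j, true) ∈ w.heightSet h := by
      rw [H, Set.mem_insert_iff]
    have h2 : (j, false) ∈ w.heightSet h' ↔ (j, false) = (i, c) ∨ (j, false) ∈ w.heightSet h := by
      rw [H, Set.mem_insert_iff]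
    rw [true_mem_heightSet, true_mem_heightSet, Prod.mk.injEq] at h1
    rw [false_mem_heightSet, false_mem_heightSet, Prod.mk.injEq] at h2
    have h3 := hh j
    have h4 := hh' j
    by_cases hj : j = i
    · subst hj
      rw [Function.update_self]
      cases c
      · rw [false_mem_heightSet] at hc
        simp at h1 h2
        omega
      · rw [true_mem_heightSet] at hc
        simp at h1 h2
        omega
    · rw [Function.update_of_ne hj]
      simp only [hj, false_and, false_or] at h1 h2
      omega
  · intro H
    have hi := hh' i
    rw [H, Function.update_self] at hi
    -- The vector `z_i ⊗ ε` has to enter first, `z_i ⊗ 1` second.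
    refine ⟨if h i = 0 then true else false, ?_, ?_⟩
    · split_ifs with h0
      · rw [true_mem_heightSet]; omega
      · rw [false_mem_heightSet]; omega
    · ext ⟨j, c⟩
      rw [Set.mem_insert_iff, Prod.mk.injEq]
      by_cases hj : j = i
      · subst hj
        cases c
        · rw [false_mem_heightSet, false_mem_heightSet, H, Function.update_self]
          split_ifs with h0 <;> simp <;> omega
        · rw [true_mem_heightSet, true_mem_heightSet, H, Function.update_self]
          split_ifs with h0 <;> simp <;> omega
      · cases c
        · rw [false_mem_heightSet, false_mem_heightSet, H, Function.update_of_ne hj]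
          simp [hj]
        · rw [true_mem_heightSet, true_mem_heightSet, H, Function.update_of_ne hj]
          simp [hj]

end QWalk

/-! ### The induced module and its canonical submodules -/

section Canonical

/-- The basis `1, ε` of the dual numbers. -/
def dualNumberBasis (K : Type*) [Field K] : Module.Basis Bool K (DualNumber K) :=
  Module.Basis.ofEquivFun
    { toFun := fun x b => if b then x.snd else x.fst
      invFun := fun f => TrivSqZeroExt.inl (f false) + TrivSqZeroExt.inr (f true)
      map_add' := fun x y => by funext b; cases b <;> simp
      map_smul' := fun c x => by funext b; cases b <;> simp
      left_inv := fun x => by ext <;> simp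
      right_inv := fun f => by funext b; cases b <;> simp }

theorem dualNumberBasis_apply (K : Type*) [Field K] (b : Bool) :
    dualNumberBasis K b = if b then DualNumber.eps else 1 := by
  cases b <;> ext <;> simp [dualNumberBasis, Module.Basis.coe_ofEquivFun]

variable {K : Type*} [Field K] {Q : Type*} [Quiver Q] [Fintype Q]
  {I : Ideal (PathAlgebra K Q)} {w : QWalk Q}

/-- The standard basis of the induced module. -/
def stdBasis (hw : w.IsString I) :
    Module.Basis (Fin (w.length + 1) × Bool) K (InducedModule hw) :=
  (Module.Basis.tensorProduct (Finsupp.basisSingleOne : Module.Basis _ K (w.Space K))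
    (dualNumberBasis K) : Module.Basis (Fin (w.length + 1) × Bool) K (w.Space K ⊗[K] DualNumber K))

theorem stdBasis_apply (hw : w.IsString I) (b : Fin (w.length + 1) × Bool) :
    stdBasis hw b = InducedModule.stdVec hw b := by
  refine (Module.Basis.tensorProduct_apply' _ _ b).trans ?_
  rw [dualNumberBasis_apply, Finsupp.coe_basisSingleOne]
  rfl

theorem coe_stdBasis (hw : w.IsString I) : ⇑(stdBasis hw) = InducedModule.stdVec hw :=
  funext (stdBasis_apply hw)

theorem mem_span_stdVec_iff {hw : w.IsString I} {S : Set (Fin (w.length + 1) × Bool)}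
    {x : InducedModule hw} : x ∈ Submodule.span K (InducedModule.stdVec hw '' S) ↔
      ↑((stdBasis hw).repr x).support ⊆ S := by
  rw [← coe_stdBasis, Module.Basis.mem_span_image]

theorem stdVec_mem_span_iff {hw : w.IsString I} {S : Set (Fin (w.length + 1) × Bool)}
    {b : Fin (w.length + 1) × Bool} :
    InducedModule.stdVec hw b ∈ Submodule.span K (InducedModule.stdVec hw '' S) ↔ b ∈ S := by
  rw [mem_span_stdVec_iff, ← stdBasis_apply, Module.Basis.repr_self]
  simp [Finsupp.support_single]

/-- The pure tensors of the induced module. -/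
def InducedModule.mk (hw : w.IsString I) :
    w.Space K →ₗ[K] DualNumber K →ₗ[K] InducedModule hw :=
  TensorProduct.mk K (w.Space K) (DualNumber K)

theorem InducedModule.stdVec_eq (hw : w.IsString I) (i : Fin (w.length + 1)) (c : Bool) :
    InducedModule.stdVec hw (i, c) =
      InducedModule.mk hw (Finsupp.single i 1) (if c then DualNumber.eps else 1) := rfl

variable [I.IsTwoSided]

instance (hw : w.IsString I) : IsScalarTower K (DualAlgebra I) (InducedModule hw) where
  smul_assoc c r m := by
    change inducedRep hw (c • r) m = c • inducedRep hw r m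
    rw [map_smul, LinearMap.smul_apply]

/-- The element `a ⊗ d` of the algebra `Λ ⊗ K[ε]/(ε²)`, for a class `a` of an element of the
path algebra. -/
def DualAlgebra.mk (I : Ideal (PathAlgebra K Q)) [I.IsTwoSided] (x : PathAlgebra K Q)
    (d : DualNumber K) : DualAlgebra I :=
  (Ideal.Quotient.mk I x) ⊗ₜ[K] d

theorem DualAlgebra.mk_smul (hw : w.IsString I) (x : PathAlgebra K Q) (d : DualNumber K)
    (z : w.Space K) (e : DualNumber K) :
    DualAlgebra.mk I x d • InducedModule.mk hw z e =
      InducedModule.mk hw (w.rep K x z) (d * e) := rfl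

theorem DualAlgebra.induction {P : DualAlgebra I → Prop} (zero : P 0)
    (add : ∀ r s, P r → P s → P (r + s))
    (mk : ∀ (c : K) p d, P (c • DualAlgebra.mk I (PathAlgebra.of p) d)) (r : DualAlgebra I) :
    P r := by
  refine TensorProduct.induction_on (motive := P) r zero (fun a d => ?_) add
  obtain ⟨x, rfl⟩ := Ideal.Quotient.mk_surjective a
  change P (DualAlgebra.mk I x d)
  induction x using PathAlgebra.ind with
  | zero =>
    have : DualAlgebra.mk I 0 d = 0 := by
      rw [DualAlgebra.mk, map_zero]; exact TensorProduct.zero_tmul _ _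
    rwa [this]
  | add x y hx hy =>
    have : DualAlgebra.mk I (x + y) d = DualAlgebra.mk I x d + DualAlgebra.mk I y d := by
      rw [DualAlgebra.mk, map_add]; exact TensorProduct.add_tmul _ _ _
    rw [this]
    exact add _ _ hx hy
  | smul c p =>
    have : DualAlgebra.mk I (c • PathAlgebra.of p) d =
        c • DualAlgebra.mk I (PathAlgebra.of p) d := rfl
    rw [this]
    exact mk c p d

/-- By linearity in both arguments it suffices to let `p ⊗ d`, with `p` a path, act on a standard
basis vector. The path moves the position along letters, and `d` can only add an `ε` component. -/
theorem smul_mem_span_of_isClosedSet {hw : w.IsString I} {S : Set (Fin (w.length + 1) × Bool)}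
    (hS : w.IsClosedSet S) (r : DualAlgebra I) {m : InducedModule hw}
    (hm : m ∈ Submodule.span K (InducedModule.stdVec hw '' S)) :
    r • m ∈ Submodule.span K (InducedModule.stdVec hw '' S) := by
  induction r using DualAlgebra.induction with
  | zero => rw [zero_smul]; exact Submodule.zero_mem _
  | add r s hr hs => rw [add_smul]; exact Submodule.add_mem _ hr hs
  | mk c p d =>
    rw [smul_assoc]
    refine Submodule.smul_mem _ _ ?_
    induction hm using Submodule.span_induction with
    | zero => rw [smul_zero]; exact Submodule.zero_mem _
    | add x y _ _ hx hy => rw [smul_add]; exact Submodule.add_mem _ hx hy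
    | smul a x _ hx =>
      -- The scalar is moved past the algebra element as a central element of the algebra.
      rw [← algebraMap_smul (DualAlgebra I) a x, ← mul_smul, ← Algebra.commutes, mul_smul,
        algebraMap_smul]
      exact Submodule.smul_mem _ _ hx
    | mem x hx =>
      obtain ⟨⟨i, b⟩, hb, rfl⟩ := hx
      rw [InducedModule.stdVec_eq, DualAlgebra.mk_smul, QWalk.rep_of]
      have hz := w.pathAct_single_mem K p.path i
      generalize w.pathAct K p.path (Finsupp.single i 1) = z at hz ⊢
      induction hz using Submodule.span_induction with
      | zero => rw [map_zero, LinearMap.zero_apply]; exact Submodule.zero_mem _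
      | add x y _ _ hx hy =>
        rw [map_add, LinearMap.add_apply]; exact Submodule.add_mem _ hx hy
      | smul a x _ hx =>
        rw [map_smul, LinearMap.smul_apply]; exact Submodule.smul_mem _ _ hx
      | mem x hx =>
        obtain ⟨j, hj, rfl⟩ := hx
        have hmem : (j, b) ∈ S := hS.reads p.path hj hb
        have hvec {c : Bool} (hc : (j, c) ∈ S) :
            InducedModule.mk hw (Finsupp.single j 1) (if c then DualNumber.eps else 1) ∈
              Submodule.span K (InducedModule.stdVec hw '' S) :=
          Submodule.subset_span ⟨_, hc, rfl⟩
        -- For `z_j ⊗ 1` both components of `d` survive, and closure under `ε` is used; for `z_j ⊗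
        -- ε` only the constant term does, since `ε² = 0`.
        cases b
        · have hd : d * (if false = true then DualNumber.eps else 1) =
              d.fst • (1 : DualNumber K) + d.snd • DualNumber.eps := by
            ext <;> simp
          rw [hd, map_add, map_smul, map_smul]
          exact Submodule.add_mem _ (Submodule.smul_mem _ _ (hvec hmem))
            (Submodule.smul_mem _ _ (hvec (hS.1 _ hmem)))
        · have hd : d * (if true = true then DualNumber.eps else 1) =
              d.fst • (DualNumber.eps : DualNumber K) := by
            ext <;> simp
          rw [hd, map_smul]
          exact Submodule.smul_mem _ _ (hvec hmem)

/-- Multiplication by `1 ⊗ ε` and by `α ⊗ 1`, for arrows `α`, realises the two closure conditions.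
Canonicity is not needed here. -/
theorem isClosedSet_setOf_stdVec_mem {hw : w.IsString I}
    (N : Submodule (DualAlgebra I) (InducedModule hw)) :
    w.IsClosedSet {b | InducedModule.stdVec hw b ∈ N} := by
  refine ⟨fun i hi => ?_, fun α i j c hs hi => ?_⟩
  · have h := N.smul_mem (DualAlgebra.mk I 1 DualNumber.eps) hi
    rw [InducedModule.stdVec_eq, DualAlgebra.mk_smul, map_one, Module.End.one_apply] at h
    simpa [InducedModule.stdVec_eq] using h
  · have h := N.smul_mem (DualAlgebra.mk I
      (PathAlgebra.of ⟨α.left, α.right, Quiver.Path.nil.cons α.hom⟩) 1) hi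
    rwa [InducedModule.stdVec_eq, DualAlgebra.mk_smul, QWalk.rep_arrow_single hw.1 hs,
      one_mul] at h

variable (I) in
/-- The canonical submodule that corresponds to a height function. -/
def heightSubmodule (hw : w.IsString I) (h : HeightFunction w.direct) :
    CanonicalSubmodule hw :=
  ⟨{ Submodule.span K (InducedModule.stdVec hw '' w.heightSet h.val) with
      smul_mem' := fun r _ hm =>
        smul_mem_span_of_isClosedSet (QWalk.isClosedSet_heightSet h.2) r hm },
    w.heightSet h.val, rfl⟩

theorem coe_heightSubmodule (hw : w.IsString I) (h : HeightFunction w.direct) :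
    ((heightSubmodule I hw h).val : Set (InducedModule hw)) =
      Submodule.span K (InducedModule.stdVec hw '' w.heightSet h.val) := rfl

theorem stdVec_mem_heightSubmodule {hw : w.IsString I} {h : HeightFunction w.direct}
    {b : Fin (w.length + 1) × Bool} :
    InducedModule.stdVec hw b ∈ (heightSubmodule I hw h).val ↔ b ∈ w.heightSet h.val :=
  stdVec_mem_span_iff

theorem heightSubmodule_le_iff {hw : w.IsString I} {h h' : HeightFunction w.direct} :
    heightSubmodule I hw h ≤ heightSubmodule I hw h' ↔ h ≤ h' := by
  refine Iff.trans ?_ (QWalk.heightSet_subset_iff h.2.1)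
  constructor
  · intro H b hb
    exact stdVec_mem_heightSubmodule.mp (H (stdVec_mem_heightSubmodule.mpr hb))
  · exact fun H => Submodule.span_mono (R := K) (Set.image_mono H)

theorem IsCanonical.coe_eq {hw : w.IsString I} {N : Submodule (DualAlgebra I) (InducedModule hw)}
    (hN : IsCanonical N) : (N : Set (InducedModule hw)) =
      Submodule.span K (InducedModule.stdVec hw '' {b | InducedModule.stdVec hw b ∈ N}) := by
  obtain ⟨S, hS⟩ := hN
  have : {b | InducedModule.stdVec hw b ∈ N} = S := by
    ext b
    rw [Set.mem_ofPred_eq, ← SetLike.mem_coe, hS, SetLike.mem_coe, stdVec_mem_span_iff]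
  rw [this, hS]

theorem heightSubmodule_surjective (hw : w.IsString I) :
    Function.Surjective (heightSubmodule I hw) := by
  intro N
  obtain ⟨h, hh, hS⟩ := (isClosedSet_setOf_stdVec_mem N.val).exists_eq_heightSet
  refine ⟨⟨h, hh⟩, Subtype.ext (SetLike.coe_injective ?_)⟩
  rw [coe_heightSubmodule, N.2.coe_eq, hS]

/-- Canonical submodules correspond to height functions. -/
def heightSubmoduleIso (hw : w.IsString I) : HeightFunction w.direct ≃o CanonicalSubmodule hw where
  toEquiv := Equiv.ofBijective (heightSubmodule I hw)
    ⟨fun _ _ H => le_antisymm (heightSubmodule_le_iff.mp H.le) (heightSubmodule_le_iff.mp H.ge),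
      heightSubmodule_surjective hw⟩
  map_rel_iff' := heightSubmodule_le_iff

theorem IsCanonical.sup {hw : w.IsString I}
    {N N' : Submodule (DualAlgebra I) (InducedModule hw)} (hN : IsCanonical N)
    (hN' : IsCanonical N') : IsCanonical (N ⊔ N') := by
  obtain ⟨S, hS⟩ := hN
  obtain ⟨S', hS'⟩ := hN'
  refine ⟨S ∪ S', ?_⟩
  ext x
  rw [Set.image_union, Submodule.span_union, SetLike.mem_coe, SetLike.mem_coe,
    Submodule.mem_sup, Submodule.mem_sup]
  simp only [← SetLike.mem_coe, hS, hS']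

/-- By linear independence, membership in a span of basis vectors is a condition on the support of
the coordinates, and such conditions intersect. -/
theorem IsCanonical.inf {hw : w.IsString I}
    {N N' : Submodule (DualAlgebra I) (InducedModule hw)} (hN : IsCanonical N)
    (hN' : IsCanonical N') : IsCanonical (N ⊓ N') := by
  obtain ⟨S, hS⟩ := hN
  obtain ⟨S', hS'⟩ := hN'
  refine ⟨S ∩ S', ?_⟩
  ext x
  rw [Submodule.coe_inf, hS, hS', Set.mem_inter_iff, SetLike.mem_coe, SetLike.mem_coe,
    SetLike.mem_coe, mem_span_stdVec_iff, mem_span_stdVec_iff, mem_span_stdVec_iff,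
    Set.subset_inter_iff]

theorem heightSubmodule_eq_bot_iff {hw : w.IsString I} {h : HeightFunction w.direct} :
    (heightSubmodule I hw h).val = ⊥ ↔ ∀ i, h.val i = 0 := by
  constructor
  · intro H i
    by_contra hi
    have h1 : InducedModule.stdVec hw (i, true) ∈ (heightSubmodule I hw h).val :=
      stdVec_mem_heightSubmodule.mpr (QWalk.true_mem_heightSet.mpr (Nat.one_le_iff_ne_zero.mpr hi))
    rw [H, Submodule.mem_bot, ← stdBasis_apply] at h1
    exact (stdBasis hw).ne_zero _ h1
  · intro H
    have : w.heightSet h.val = ∅ := by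
      ext ⟨i, c⟩
      cases c <;> simp [QWalk.heightSet, H]
    apply SetLike.coe_injective
    rw [coe_heightSubmodule, this, Set.image_empty, Submodule.span_empty]
    rfl

theorem heightSubmodule_eq_top_iff {hw : w.IsString I} {h : HeightFunction w.direct} :
    (heightSubmodule I hw h).val = ⊤ ↔ ∀ i, h.val i = 2 := by
  constructor
  · intro H i
    have h1 : InducedModule.stdVec hw (i, false) ∈ (heightSubmodule I hw h).val :=
      H ▸ Submodule.mem_top
    exact le_antisymm (h.2.1 i) (QWalk.false_mem_heightSet.mp (stdVec_mem_heightSubmodule.mp h1))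
  · intro H
    have : w.heightSet h.val = Set.univ := by
      ext ⟨i, c⟩
      cases c <;> simp [QWalk.heightSet, H]
    apply SetLike.coe_injective
    rw [coe_heightSubmodule, this, Set.image_univ, ← coe_stdBasis, (stdBasis hw).span_eq]
    rfl

/-- Once `N'` is spanned by `N` and one further basis vector, simplicity of `N' / N` is automatic,
as this quotient has dimension one over `K`. Only the index sets remain to be compared. -/
theorem addsTop_heightSubmodule_iff {hw : w.IsString I} {h h' : HeightFunction w.direct}
    {i : Fin (w.length + 1)} :
    AddsTop i (heightSubmodule I hw h).val (heightSubmodule I hw h').val ↔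
      HeightFunction.Raise i h h' := by
  have hspan (c : Bool) : Submodule.span K
      (((heightSubmodule I hw h).val : Set (InducedModule hw)) ∪
        {InducedModule.stdVec hw (i, c)}) =
      Submodule.span K (InducedModule.stdVec hw '' insert (i, c) (w.heightSet h.val)) := by
    rw [coe_heightSubmodule, Submodule.span_union, Submodule.span_span, ← Submodule.span_union,
      Set.image_insert_eq, Set.union_singleton]
  refine Iff.trans ?_ (QWalk.heightSet_eq_insert_iff h.2.1 h'.2.1)
  constructor
  · rintro ⟨-, -, c, hc, H⟩
    refine ⟨c, fun hc' => hc (stdVec_mem_heightSubmodule.mpr hc'), Set.ext fun b => ?_⟩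
    rw [← stdVec_mem_heightSubmodule (I := I) (hw := hw), ← SetLike.mem_coe, H, hspan,
      SetLike.mem_coe, stdVec_mem_span_iff]
  · rintro ⟨c, hc, H⟩
    have hc' : InducedModule.stdVec hw (i, c) ∉ (heightSubmodule I hw h).val := fun h1 =>
      hc (stdVec_mem_heightSubmodule.mp h1)
    have hle : (heightSubmodule I hw h).val ≤ (heightSubmodule I hw h').val :=
      Submodule.span_mono (R := K) (Set.image_mono (H ▸ Set.subset_insert _ _))
    refine ⟨hle, ?_, c, hc', by rw [hspan, coe_heightSubmodule, H]⟩
    -- Restriction of scalars to `K` is an order embedding and so reflects cover relations; over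
    -- `K`, adjoining one vector outside a subspace gives a cover.
    refine (covBy_iff_quot_is_simple hle).mp (CovBy.of_image
      (Submodule.restrictScalarsEmbedding K (DualAlgebra I) (InducedModule hw)) ?_)
    have hcov := Submodule.covBy_span_singleton_sup (K := K)
      (s := (heightSubmodule I hw h).val.restrictScalars K) hc'
    have hsup : (heightSubmodule I hw h').val.restrictScalars K =
        Submodule.span K {InducedModule.stdVec hw (i, c)} ⊔
          (heightSubmodule I hw h).val.restrictScalars K := by
      apply SetLike.coe_injective
      rw [Submodule.coe_restrictScalars, coe_heightSubmodule, H, Set.image_insert_eq,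
        Submodule.span_insert]
      rfl
    rw [← hsup] at hcov
    exact hcov

end Canonical

end

/-! ### The isomorphism through height functions -/

theorem theorem4p10 {K : Type*} [Field K] {Q : Type*} [Quiver Q] [Fintype Q]
    (I : Ideal (PathAlgebra K Q)) [I.IsTwoSided] (w : QWalk Q) (hw : w.IsString I)
    (G : SnakeGraph w.length) (hG : SnakeGraph.IsSnakeGraphOf w G) :
    -- the double dimer covers form a lattice under tile twists
    (∀ D D' : G.DoubleDimerCover, (∃ J, IsLUB {D, D'} J) ∧ ∃ J, IsGLB {D, D'} J) ∧
    -- the canonical submodules form a lattice under sums and intersections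
    (∀ N N' : CanonicalSubmodule hw, IsCanonical (N.val ⊔ N'.val) ∧ IsCanonical (N.val ⊓ N'.val)) ∧
    -- the two lattices are isomorphic
    ∃ Φ : G.DoubleDimerCover ≃o CanonicalSubmodule hw,
      -- the minimal cover corresponds to zero and the maximal one to the whole module
      (∀ D, G.IsMinimal D ↔ (Φ D).val = ⊥) ∧
      (∀ D, G.IsMaximal D ↔ (Φ D).val = ⊤) ∧
      -- `Φ D` is read off from the symmetric difference of `D` and the minimal cover
      (∀ D D₀, G.IsMinimal D₀ → ∀ i, ∀ e ∈ G.tileEdges i, G.IsBoundary e →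
        (InducedModule.stdVec hw (i, true) ∈ (Φ D).val ↔
          1 ≤ (SnakeGraph.multisetSymmDiff D.val D₀.val).count e) ∧
        (InducedModule.stdVec hw (i, false) ∈ (Φ D).val ↔
          2 ≤ (SnakeGraph.multisetSymmDiff D.val D₀.val).count e)) ∧
      -- cover relations are single twists on one side and single tops on the other
      (∀ D D', D ⋖ D' ↔ ∃ i, G.UpTwist i D D') ∧
      (∀ N N' : CanonicalSubmodule hw, N ⋖ N' ↔ ∃ i, AddsTop i N.val N'.val) ∧
      (∀ i D D', G.UpTwist i D D' ↔ AddsTop i (Φ D).val (Φ D').val) := by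
  have hd := fun k => hG.direct_iff k
  let E := SnakeGraph.heightCoverIso (G := G) hd
  let F := heightSubmoduleIso (I := I) hw
  have hF' (h) : F h = heightSubmodule I hw h := rfl
  have hE' (h) : E h = G.heightCover hd h := rfl
  have hΦ (h) : (E.symm.trans F) (G.heightCover hd h) = heightSubmodule I hw h := by
    rw [← hE', OrderIso.trans_apply, OrderIso.symm_apply_apply, hF']
  refine ⟨fun D D' => ?_, fun N N' => ⟨N.2.sup N'.2, N.2.inf N'.2⟩, E.symm.trans F,
    fun D => ?_, fun D => ?_, fun D D₀ hD₀ i e hi he => ?_, fun D D' => ?_, fun N N' => ?_,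
    fun i D D' => ?_⟩
  -- Suprema and infima are pointwise for height functions and are carried over by the order
  -- isomorphism.
  · have hpair : E.symm '' {D, D'} = {E.symm D, E.symm D'} := Set.image_pair _ _ _
    obtain ⟨J, hJ⟩ := HeightFunction.exists_isLUB (E.symm D) (E.symm D')
    obtain ⟨J', hJ'⟩ := HeightFunction.exists_isGLB (E.symm D) (E.symm D')
    rw [← hpair] at hJ hJ'
    exact ⟨⟨_, E.symm.isLUB_image.mp hJ⟩, ⟨_, E.symm.isGLB_image.mp hJ'⟩⟩
  · obtain ⟨h, rfl⟩ := SnakeGraph.heightCover_surjective hd D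
    rw [hΦ, SnakeGraph.isMinimal_heightCover_iff, heightSubmodule_eq_bot_iff]
  · obtain ⟨h, rfl⟩ := SnakeGraph.heightCover_surjective hd D
    rw [hΦ, SnakeGraph.isMaximal_heightCover_iff, heightSubmodule_eq_top_iff]
  · obtain ⟨h, rfl⟩ := SnakeGraph.heightCover_surjective hd D
    rw [hΦ, stdVec_mem_heightSubmodule, stdVec_mem_heightSubmodule, QWalk.true_mem_heightSet,
      QWalk.false_mem_heightSet,
      SnakeGraph.count_multisetSymmDiff_heightCover hd h hD₀ hi he]
    exact ⟨Iff.rfl, Iff.rfl⟩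
  · obtain ⟨h, rfl⟩ := SnakeGraph.heightCover_surjective hd D
    obtain ⟨h', rfl⟩ := SnakeGraph.heightCover_surjective hd D'
    simp only [SnakeGraph.upTwist_heightCover_iff]
    rw [← hE', ← hE', apply_covBy_apply_iff, HeightFunction.covBy_iff]
  · obtain ⟨h, rfl⟩ := heightSubmodule_surjective hw N
    obtain ⟨h', rfl⟩ := heightSubmodule_surjective hw N'
    simp only [addsTop_heightSubmodule_iff]
    rw [← hF', ← hF', apply_covBy_apply_iff, HeightFunction.covBy_iff]
  · obtain ⟨h, rfl⟩ := SnakeGraph.heightCover_surjective hd D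
    obtain ⟨h', rfl⟩ := SnakeGraph.heightCover_surjective hd D'
    rw [hΦ, hΦ, SnakeGraph.upTwist_heightCover_iff, addsTop_heightSubmodule_iff]
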